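/- Let $\gamma>0$, $\rho^*>0$ and $p(\rho)=\bigl(\tfrac1\rho-\tfrac1{\rho^*}\bigr)^{-\gamma}$ for $0<\rho<\rho^*$. For $\varepsilon>0$ consider the system $$\partial_t\rho+\partial_x q=0,\qquad \partial_t q+\partial_x\Bigl(\frac{q^2}{\rho}+\varepsilon p(\rho)\Bigr)=0,$$ with characteristic speeds $\lambda_\pm^\varepsilon=\frac q\rho\pm\sqrt{\varepsilon p'(\rho)}$ ($-$: first family, $+$: second family), and the Riemann problem with left state $(\rho_\ell^\varepsilon,q_\ell^\varepsilon)$ and right state $(\rho_r^\varepsilon,q_r^\varepsilon)$, where $0<\rho_\ell^\varepsilon,\rho_r^\varepsilon<\rho^*$. The states may depend on $\varepsilon$ (or be constant), and we assume that, as $\varepsilon\to0^+$, $(\rho_\ell^\varepsilon,q_\ell^\varepsilon,\varepsilon p(\rho_\ell^\varepsilon))\to(\rho_\ell,q_\ell,\bar p_\ell)$ and $(\rho_r^\varepsilon,q_r^\varepsilon,\varepsilon p(\rho_r^\varepsilon))\to(\rho_r,q_r,\bar p_r)$ with finite limits and $\rho_\ell,\rho_r\in(0,\rho^*]$. Put $u_\ell^\varepsilon=q_\ell^\varepsilon/\rho_\ell^\varepsilon$,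 $u_\ell=q_\ell/\rho_\ell$, and similarly $u_r^\varepsilon,u_r$. A solution of the Riemann problem is a self-similar function $(\rho,q)(x/t)$, $t>0$, made of finitely many constant states separated by waves, the first state being the left one and the last state the right one. A wave of the $k$-th family is either a $k$-rarefaction (a continuous self-similar solution, of positive density and classical in the interior of a sector, each ray of which is a $k$-characteristic; an end state may be the vacuum $(0,0)$) or an entropic $k$-shock (a discontinuity between two states of positive density that satisfies the Rankine–Hugoniot conditions and Lax's entropy condition $\lambda_k(\text{right})<\sigma<\lambda_k(\text{left})$). For a state $(\hat\rho,\hat q)$, $\hat u=\hat q/\hat\rho$, the integral and Hugoniot curves issued from it are, for $0\le\rho<\rho^*$, $$i_\pm^\varepsilon(\rho)=\rho\hat u\pm\rho\sqrt\varepsilon\,(P(\rho)-P(\hat\rho)),\qquad P'(\rho)=\frac{\sqrt{p'(\rho)}}{\rho},$$ $$h_\pm^\varepsilon(\rho)=\rho\hat u\pm\operatorname{sgn}(\rho-\hat\rho)\sqrt{\frac{\rho}{\hat\rho}}\sqrt{(\rho-\hat\rho)(\varepsilon p(\rho)-\varepsilon p(\hat\rho))},$$ with value $0$ at $\rho=0$.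 Below, the 1-curves $i_-^\varepsilon,h_-^\varepsilon$ are issued from the left state and the 2-curves $i_+^\varepsilon,h_+^\varepsilon$ from the right state. The intersection point of two such curves is their intersection point with positive density, which is unique when it exists, or else the vacuum $(0,0)$. In each case below the Riemann problem has a solution, and all its solutions consist of the left state, a wave of the first family, one and the same intermediate state $(\tilde\rho,\tilde q)$, a wave of the second family, and the right state, as follows. 1. If $u_\ell<u_r$, then for all sufficiently small $\varepsilon>0$ both waves are rarefactions, $(\tilde\rho,\tilde q)$ is the intersection point of the 1-integral curve and the 2-integral curve (possibly the vacuum), and $\tilde\rho<\rho_\ell^\varepsilon$, $\tilde\rho<\rho_r^\varepsilon$. 2. For all sufficiently small $\varepsilon>0$, if $u_\ell^\varepsilon>u_r^\varepsilon$ (which holds for all small $\varepsilon$ when $u_\ell>u_r$): * if $h_-^\varepsilon(\rho_r^\varepsilon)>q_r^\varepsilon$ and $h_+^\varepsilon(\rho_\ell^\varepsilon)<q_\ell^\varepsilon$, both waves are shocks and $(\tilde\rho,\tilde q)$ is the intersection point of the 1-Hugoniot curve and the 2-Hugoniot curve; * if $h_-^\varepsilon(\rho_r^\varepsilon)<q_r^\varepsilon$,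 the waves are a 1-shock and a 2-rarefaction and $(\tilde\rho,\tilde q)$ is the intersection point of the 1-Hugoniot curve and the 2-integral curve; * if $h_+^\varepsilon(\rho_\ell^\varepsilon)>q_\ell^\varepsilon$, the waves are a 1-rarefaction and a 2-shock and $(\tilde\rho,\tilde q)$ is the intersection point of the 1-integral curve and the 2-Hugoniot curve. 3. For every $\varepsilon>0$ with $u_\ell^\varepsilon=u_r^\varepsilon$: if $\rho_\ell^\varepsilon<\rho_r^\varepsilon$, the waves are a 1-shock and a 2-rarefaction, $(\tilde\rho,\tilde q)$ is the intersection point of the 1-Hugoniot curve and the 2-integral curve, and $\tilde\rho\in[\rho_\ell^\varepsilon,\rho_r^\varepsilon]$; if $\rho_\ell^\varepsilon>\rho_r^\varepsilon$, the waves are a 1-rarefaction and a 2-shock, $(\tilde\rho,\tilde q)$ is the intersection point of the 1-integral curve and the 2-Hugoniot curve, and $\tilde\rho\in[\rho_r^\varepsilon,\rho_\ell^\varepsilon]$. -/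

import Mathlib

open Set Filter Topology

noncomputable section

/-- The singular pressure `p(ρ) = 1 / (1/ρ - 1/ρ*)^γ`, meaningful for `0 < ρ < ρ*`. -/
def pressure (γ ρs ρ : ℝ) : ℝ := 1 / (1 / ρ - 1 / ρs) ^ γ

/-- The two characteristic families (first: sign `-`, second: sign `+`). -/
inductive Family
  | first
  | second

/-- The sign `∓` attached to a characteristic family. -/
def Family.sgn : Family → ℝ
  | .first => -1
  | .second => 1

/-- Characteristic speeds `λ_± = u ± √(ε p'(ρ))`, `u = q/ρ`, at a state `(ρ, q)` with `ρ > 0`. -/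
def charSpeed (γ ρs ε : ℝ) (k : Family) (v : ℝ × ℝ) : ℝ :=
  v.2 / v.1 + k.sgn * Real.sqrt (ε * deriv (pressure γ ρs) v.1)

/-- The antiderivative of `√(p'(s)) / s` on `(0, ρ*)` that vanishes at `ρ*/2`
(only differences of its values are used). -/
def soundPotential (γ ρs ρ : ℝ) : ℝ :=
  ∫ s in (ρs / 2)..ρ, Real.sqrt (deriv (pressure γ ρs) s) / s

/-- The integral curves `i_±(ρ) = ρ û ± ρ √ε (P(ρ) - P(ρ̂))` issued from `v = (ρ̂, q̂)`;
in particular `i_±(0) = 0`. -/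
def integralCurve (γ ρs ε : ℝ) (k : Family) (v : ℝ × ℝ) (ρ : ℝ) : ℝ :=
  ρ * (v.2 / v.1) +
    k.sgn * (ρ * Real.sqrt ε * (soundPotential γ ρs ρ - soundPotential γ ρs v.1))

/-- The Hugoniot curves issued from `v = (ρ̂, q̂)`:
`h_±(ρ) = ρ û ± sign(ρ - ρ̂) √(ρ/ρ̂) √((ρ - ρ̂)(ε p(ρ) - ε p(ρ̂)))`, that is
`h_±(ρ) = q̂ + σ_± (ρ - ρ̂)` with the shock speeds
`σ_± = û ± √(ρ/ρ̂) √((ε p(ρ) - ε p(ρ̂)) / (ρ - ρ̂))`; in particular `h_±(0) = 0`. -/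
def hugoniotCurve (γ ρs ε : ℝ) (k : Family) (v : ℝ × ℝ) (ρ : ℝ) : ℝ :=
  ρ * (v.2 / v.1) +
    k.sgn * (Real.sign (ρ - v.1) * (Real.sqrt (ρ / v.1) *
      Real.sqrt ((ρ - v.1) * (ε * pressure γ ρs ρ - ε * pressure γ ρs v.1))))

/-- The momentum flux `q²/ρ + ε p(ρ)`. -/
def momentumFlux (γ ρs ε ρ q : ℝ) : ℝ := q ^ 2 / ρ + ε * pressure γ ρs ρ

/-- `(ρ, q)(t, x)` is differentiable at `(t, x)` in `t` and in `x` and satisfies there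
`∂ₜρ + ∂ₓq = 0` and `∂ₜq + ∂ₓ(q²/ρ + ε p(ρ)) = 0`. -/
def SolvesEulerAt (γ ρs ε : ℝ) (ρ q : ℝ → ℝ → ℝ) (t x : ℝ) : Prop :=
  ∃ ρt ρx qt qx fx : ℝ,
    HasDerivAt (fun s => ρ s x) ρt t ∧ HasDerivAt (fun y => ρ t y) ρx x ∧
    HasDerivAt (fun s => q s x) qt t ∧ HasDerivAt (fun y => q t y) qx x ∧
    HasDerivAt (fun y => momentumFlux γ ρs ε (ρ t y) (q t y)) fx x ∧
    ρt + qx = 0 ∧ qt + fx = 0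

/-- The two states `L` (left) and `R` (right) are separated by an entropic `k`-shock of speed `σ`:
the Rankine-Hugoniot conditions and Lax's entropy condition hold. (A jump to the vacuum never
satisfies the Rankine-Hugoniot conditions, so both densities are positive.) -/
def IsShock (γ ρs ε : ℝ) (k : Family) (σ : ℝ) (L R : ℝ × ℝ) : Prop :=
  (0 < L.1 ∧ L.1 < ρs) ∧ (0 < R.1 ∧ R.1 < ρs) ∧
  R.2 - L.2 = σ * (R.1 - L.1) ∧
  momentumFlux γ ρs ε R.1 R.2 - momentumFlux γ ρs ε L.1 L.2 = σ * (R.2 - L.2) ∧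
  charSpeed γ ρs ε k R < σ ∧ σ < charSpeed γ ρs ε k L

/-- The self-similar function `(t, x) ↦ U (x / t)` is on the sector `a ≤ x/t ≤ b` a (centred)
`k`-rarefaction wave joining `L` to `R`: it is continuous, takes the values `L` and `R` on the two
edges, and inside it has positive density, is a classical solution of the system, and each ray
`x/t = ξ` is a `k`-characteristic. An end state may be the vacuum. -/
def IsRarefaction (γ ρs ε : ℝ) (k : Family) (U : ℝ → ℝ × ℝ) (a b : ℝ) (L R : ℝ × ℝ) : Prop :=
  a < b ∧ ContinuousOn U (Icc a b) ∧ U a = L ∧ U b = R ∧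
  ∀ ξ ∈ Ioo a b,
    (0 < (U ξ).1 ∧ (U ξ).1 < ρs) ∧ charSpeed γ ρs ε k (U ξ) = ξ ∧
    ∀ t x : ℝ, 0 < t → x / t = ξ →
      SolvesEulerAt γ ρs ε (fun s y => (U (y / s)).1) (fun s y => (U (y / s)).2) t x

/-- The nature of a wave. -/
inductive WaveKind
  | shock
  | rarefaction

/-- `U` has on `[a, b]` a wave of family `k` and nature `w` joining `L` to `R`
(a shock occupies the single ray `a = b`). -/
def IsWave (γ ρs ε : ℝ) (k : Family) (w : WaveKind) (U : ℝ → ℝ × ℝ) (a b : ℝ) (L R : ℝ × ℝ) :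
    Prop :=
  match w with
  | .shock => a = b ∧ IsShock γ ρs ε k a L R
  | .rarefaction => IsRarefaction γ ρs ε k U a b L R

/-- `IsFan U r c v`: to the right of `c` the profile `U` consists of finitely many constant states
separated by shock or rarefaction waves (of any family, in any number), the first constant state
being `v` and the last one `r`. -/
inductive IsFan (γ ρs ε : ℝ) (U : ℝ → ℝ × ℝ) (r : ℝ × ℝ) : ℝ → ℝ × ℝ → Prop
  | const (c : ℝ) (h : ∀ ξ, c < ξ → U ξ = r) : IsFan γ ρs ε U r c r
  | wave (c a b : ℝ) (v v' : ℝ × ℝ) (k : Family) (w : WaveKind) (hca : c < a)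
      (h : ∀ ξ ∈ Ioo c a, U ξ = v) (hw : IsWave γ ρs ε k w U a b v v')
      (hf : IsFan γ ρs ε U r b v') : IsFan γ ρs ε U r c v

/-- `(t, x) ↦ U (x / t)` is a solution, for `t > 0`, of the Riemann problem with left state `l` and
right state `r`: it is made of finitely many constant states separated by rarefaction waves and
entropic shock waves; it equals `l` for `x/t` near `-∞` and `r` for `x/t` near `+∞`, hence its
initial values are `l` on `x < 0` and `r` on `x > 0`. -/
def IsRiemannSolution (γ ρs ε : ℝ) (l r : ℝ × ℝ) (U : ℝ → ℝ × ℝ) : Prop :=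
  ∃ c : ℝ, (∀ ξ, ξ ≤ c → U ξ = l) ∧ IsFan γ ρs ε U r c l

/-- `U` consists of exactly the three constant states `l`, `m`, `r`, with a wave of the first family
and of nature `w₁` between `l` and `m`, and a wave of the second family and of nature `w₂`
between `m` and `r`. -/
def HasForm (γ ρs ε : ℝ) (l r : ℝ × ℝ) (w₁ w₂ : WaveKind) (m : ℝ × ℝ) (U : ℝ → ℝ × ℝ) : Prop :=
  ∃ a₁ b₁ a₂ b₂ : ℝ, a₁ ≤ b₁ ∧ b₁ < a₂ ∧ a₂ ≤ b₂ ∧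
    (∀ ξ, ξ < a₁ → U ξ = l) ∧
    IsWave γ ρs ε .first w₁ U a₁ b₁ l m ∧
    (∀ ξ ∈ Ioo b₁ a₂, U ξ = m) ∧
    IsWave γ ρs ε .second w₂ U a₂ b₂ m r ∧
    (∀ ξ, b₂ < ξ → U ξ = r)

/-- The Riemann problem has a solution, and all its solutions have the given form with the given
intermediate state `m`. -/
def RiemannSolvedBy (γ ρs ε : ℝ) (l r : ℝ × ℝ) (w₁ w₂ : WaveKind) (m : ℝ × ℝ) : Prop :=
  (∃ U, IsRiemannSolution γ ρs ε l r U) ∧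
  ∀ U, IsRiemannSolution γ ρs ε l r U → HasForm γ ρs ε l r w₁ w₂ m U

/-- The curve on which the states that a wave of nature `w` and family `k` joins to `v` are sought:
the integral curve for a rarefaction, the Hugoniot curve for a shock. -/
def waveCurve (γ ρs ε : ℝ) (k : Family) (w : WaveKind) (v : ℝ × ℝ) (ρ : ℝ) : ℝ :=
  match w with
  | .shock => hugoniotCurve γ ρs ε k v ρ
  | .rarefaction => integralCurve γ ρs ε k v ρ

/-- `m` is the intersection point of the graphs of `f` and `g` over `[0, ρ*)`. All the curves
considered here pass through the vacuum `(0, 0)`: `m` is the only intersection point of positive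
density if there is one, and `m` may be the vacuum only if there is none. -/
def IsIntersectionPoint (ρs : ℝ) (f g : ℝ → ℝ) (m : ℝ × ℝ) : Prop :=
  0 ≤ m.1 ∧ m.1 < ρs ∧ m.2 = f m.1 ∧ m.2 = g m.1 ∧
  ∀ ρ, 0 < ρ → ρ < ρs → f ρ = g ρ → ρ = m.1

/-- The Riemann problem is solved by a 1-wave of nature `w₁` and a 2-wave of nature `w₂`, and the
intermediate state `m` is the intersection point of the 1-curve of the corresponding kind issued
from `l` and the 2-curve of the corresponding kind issued from `r`. -/
def SolvedByCurves (γ ρs ε : ℝ) (l r : ℝ × ℝ) (w₁ w₂ : WaveKind) (m : ℝ × ℝ) : Prop :=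
  RiemannSolvedBy γ ρs ε l r w₁ w₂ m ∧
  IsIntersectionPoint ρs (waveCurve γ ρs ε .first w₁ l) (waveCurve γ ρs ε .second w₂ r) m

end

/-!
Across a wave of one family that joins two densities the velocity jumps by an amount depending only
on the two densities. Along the composite wave curve issued from a state (the integral curve below
the density of the state, where the entropic wave is a rarefaction, and the Hugoniot curve above it,
where it is a shock) this jump is strictly increasing in the density and tends to `∞` at `ρ*`.
First-family waves are slower than the fluid and second-family waves faster, so a solution has at
most one wave of each family; the density of the state between them is then the unique root of
`J(ρ) = u_ℓ - u_r`, where `J(ρ)` is the sum of the jumps from the two outer states, or vacuum if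
`u_ℓ - u_r` is at most the limit of `J` at `0`. Comparing `u_ℓ - u_r` with `J(ρ_ℓ)` and `J(ρ_r)`
locates the root, hence decides the nature of the two waves. The second family is reduced to the
first by the reflection `x ↦ -x`.

As `ε → 0⁺`, `√ε P(ρ^ε) → 0`: in terms of the specific volume `τ = 1/ρ` and the impedance
`Z = ρ √p'`, one has `dP = -Z dτ` and `dp = -Z² dτ`, so that `2 dP ≤ c dp - c⁻¹ dτ` for all `c > 0`,
and `ε p(ρ^ε)` is bounded. Hence rarefactions only ever produce vanishing velocity jumps between the
two outer densities, and `u_ℓ < u_r` forces two rarefactions for small `ε`.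
-/

variable {γ ρs ρ a b : ℝ}

/-- The acoustic impedance `ρ √p'(ρ)`, in closed form. It is the derivative of `-P` with respect to
the specific volume `1/ρ`. -/
noncomputable def impedance (γ ρs ρ : ℝ) : ℝ := √γ * (1 / ρ - 1 / ρs) ^ (-((γ + 1) / 2))

/-- The potential `P + √p'`: along a curve with constant Riemann invariant the characteristic speed
varies by `√ε` times the variation of this potential. -/
noncomputable def speedPotential (γ ρs ρ : ℝ) : ℝ := soundPotential γ ρs ρ + impedance γ ρs ρ / ρ

lemma specificVolume_excess_pos (hρ : ρ ∈ Ioo 0 ρs) : 0 < 1 / ρ - 1 / ρs :=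
  sub_pos.2 (one_div_lt_one_div_of_lt hρ.1 hρ.2)

lemma hasDerivAt_specificVolume_excess (hρ : ρ ≠ 0) :
    HasDerivAt (fun x : ℝ => 1 / x - 1 / ρs) (-(1 / ρ ^ 2)) ρ := by
  simpa [one_div] using (hasDerivAt_inv hρ).sub_const (1 / ρs)

lemma exists_density_of_excess {w : ℝ} (hρs : 0 < ρs) (hw : 0 < w) :
    ∃ ρ ∈ Ioo 0 ρs, 1 / ρ - 1 / ρs = w := by
  have hi : 0 < 1 / ρs := one_div_pos.2 hρs
  refine ⟨1 / (w + 1 / ρs), ⟨by positivity, ?_⟩, by rw [one_div_one_div]; ring⟩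
  simpa using one_div_lt_one_div_of_lt hi (lt_add_of_pos_left (1 / ρs) hw)

lemma tendsto_specificVolume_excess_right (hρs : 0 < ρs) :
    Tendsto (fun ρ => 1 / ρ - 1 / ρs) (𝓝[<] ρs) (𝓝[>] 0) := by
  refine tendsto_nhdsWithin_iff.2 ⟨?_, ?_⟩
  · have h : ContinuousAt (fun ρ : ℝ => 1 / ρ - 1 / ρs) ρs :=
      (hasDerivAt_specificVolume_excess hρs.ne').continuousAt
    simpa [ContinuousAt] using h.tendsto.mono_left nhdsWithin_le_nhds
  · filter_upwards [Ioo_mem_nhdsLT hρs] with x hx using specificVolume_excess_pos hx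

lemma tendsto_specificVolume_excess_zero :
    Tendsto (fun ρ => 1 / ρ - 1 / ρs) (𝓝[>] 0) atTop := by
  simpa only [one_div, sub_eq_add_neg] using
    tendsto_atTop_add_const_right _ (-ρs⁻¹) tendsto_inv_nhdsGT_zero

/-! ### Pressure, impedance and the two potentials -/

lemma impedance_pos (hγ : 0 < γ) (hρ : ρ ∈ Ioo 0 ρs) : 0 < impedance γ ρs ρ :=
  mul_pos (Real.sqrt_pos.2 hγ) (Real.rpow_pos_of_pos (specificVolume_excess_pos hρ) _)

lemma impedance_sq (hγ : 0 < γ) (hρ : ρ ∈ Ioo 0 ρs) :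
    impedance γ ρs ρ ^ 2 = γ * (1 / ρ - 1 / ρs) ^ (-γ - 1) := by
  have hw := specificVolume_excess_pos hρ
  rw [impedance, mul_pow, Real.sq_sqrt hγ.le, ← Real.rpow_mul_natCast hw.le]
  congr 2
  push_cast
  ring

lemma hasDerivAt_impedance (hρ : ρ ∈ Ioo 0 ρs) :
    HasDerivAt (impedance γ ρs)
      ((γ + 1) / 2 * impedance γ ρs ρ / ((1 / ρ - 1 / ρs) * ρ ^ 2)) ρ := by
  have hw := specificVolume_excess_pos hρ
  refine (((hasDerivAt_specificVolume_excess hρ.1.ne').rpow_const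
    (p := -((γ + 1) / 2)) (Or.inl hw.ne')).const_mul √γ).congr_deriv ?_
  rw [Real.rpow_sub_one hw.ne', impedance]
  have := hρ.1
  field_simp

lemma impedance_deriv_pos (hγ : 0 < γ) (hρ : ρ ∈ Ioo 0 ρs) :
    0 < (γ + 1) / 2 * impedance γ ρs ρ / ((1 / ρ - 1 / ρs) * ρ ^ 2) := by
  have := impedance_pos hγ hρ
  have := specificVolume_excess_pos hρ
  have := hρ.1
  positivity

lemma continuousOn_impedance : ContinuousOn (impedance γ ρs) (Ioo 0 ρs) := fun _ hρ =>
  (hasDerivAt_impedance hρ).continuousAt.continuousWithinAt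

lemma strictMonoOn_Ioo_of_hasDerivAt_pos {f f' : ℝ → ℝ} (hf : ∀ x ∈ Ioo a b, HasDerivAt f (f' x) x)
    (hf' : ∀ x ∈ Ioo a b, 0 < f' x) : StrictMonoOn f (Ioo a b) := by
  refine strictMonoOn_of_deriv_pos (convex_Ioo a b)
    (fun x hx => (hf x hx).continuousAt.continuousWithinAt) fun x hx => ?_
  rw [interior_Ioo] at hx
  rw [(hf x hx).deriv]
  exact hf' x hx

lemma strictMonoOn_impedance (hγ : 0 < γ) : StrictMonoOn (impedance γ ρs) (Ioo 0 ρs) :=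
  strictMonoOn_Ioo_of_hasDerivAt_pos (fun _ => hasDerivAt_impedance)
    fun _ => impedance_deriv_pos hγ

lemma tendsto_impedance_zero (hγ : 0 < γ) : Tendsto (impedance γ ρs) (𝓝[>] 0) (𝓝 0) := by
  have h := ((tendsto_rpow_neg_atTop (y := (γ + 1) / 2) (by positivity)).comp
    (tendsto_specificVolume_excess_zero (ρs := ρs))).const_mul √γ
  rwa [mul_zero] at h

lemma pressure_eq_rpow (hρ : ρ ∈ Ioo 0 ρs) : pressure γ ρs ρ = (1 / ρ - 1 / ρs) ^ (-γ) := by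
  rw [pressure, Real.rpow_neg (specificVolume_excess_pos hρ).le, one_div ((_ : ℝ) ^ γ)]

lemma pressure_pos (hρ : ρ ∈ Ioo 0 ρs) : 0 < pressure γ ρs ρ :=
  one_div_pos.2 (Real.rpow_pos_of_pos (specificVolume_excess_pos hρ) _)

lemma hasDerivAt_pressure (hγ : 0 < γ) (hρ : ρ ∈ Ioo 0 ρs) :
    HasDerivAt (pressure γ ρs) (impedance γ ρs ρ ^ 2 / ρ ^ 2) ρ := by
  have h := (hasDerivAt_specificVolume_excess hρ.1.ne').rpow_const (p := -γ)
    (Or.inl (specificVolume_excess_pos hρ).ne')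
  refine (h.congr_of_eventuallyEq ?_).congr_deriv ?_
  · filter_upwards [Ioo_mem_nhds hρ.1 hρ.2] with x hx using pressure_eq_rpow hx
  · rw [impedance_sq hγ hρ]; ring

lemma strictMonoOn_pressure (hγ : 0 < γ) : StrictMonoOn (pressure γ ρs) (Ioo 0 ρs) :=
  strictMonoOn_Ioo_of_hasDerivAt_pos (fun _ => hasDerivAt_pressure hγ) fun _ hx =>
    div_pos (pow_pos (impedance_pos hγ hx) 2) (pow_pos hx.1 2)

lemma continuousOn_pressure (hγ : 0 < γ) : ContinuousOn (pressure γ ρs) (Ioo 0 ρs) := fun _ hρ =>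
  (hasDerivAt_pressure hγ hρ).continuousAt.continuousWithinAt

lemma tendsto_pressure_atTop (hγ : 0 < γ) (hρs : 0 < ρs) :
    Tendsto (pressure γ ρs) (𝓝[<] ρs) atTop := by
  refine ((tendsto_rpow_neg_nhdsGT_zero (neg_neg_of_pos hγ)).comp
    (tendsto_specificVolume_excess_right hρs)).congr' ?_
  filter_upwards [Ioo_mem_nhdsLT hρs] with x hx using (pressure_eq_rpow hx).symm

lemma sqrt_deriv_pressure (hγ : 0 < γ) (hρ : ρ ∈ Ioo 0 ρs) :
    √(deriv (pressure γ ρs) ρ) = impedance γ ρs ρ / ρ := by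
  rw [(hasDerivAt_pressure hγ hρ).deriv, ← div_pow,
    Real.sqrt_sq (div_pos (impedance_pos hγ hρ) hρ.1).le]

lemma charSpeed_eq {ε : ℝ} {v : ℝ × ℝ} (k : Family) (hγ : 0 < γ) (hε : 0 ≤ ε)
    (hv : v.1 ∈ Ioo 0 ρs) :
    charSpeed γ ρs ε k v = v.2 / v.1 + k.sgn * (√ε * (impedance γ ρs v.1 / v.1)) := by
  rw [charSpeed, Real.sqrt_mul hε, sqrt_deriv_pressure hγ hv]

lemma hasDerivAt_soundPotential (hγ : 0 < γ) (hρ : ρ ∈ Ioo 0 ρs) :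
    HasDerivAt (soundPotential γ ρs) (impedance γ ρs ρ / ρ ^ 2) ρ := by
  have hc : ContinuousOn (fun s => √(deriv (pressure γ ρs) s) / s) (Ioo 0 ρs) := by
    have hne : ∀ x ∈ Ioo 0 ρs, id x ≠ 0 := fun _ hx => hx.1.ne'
    refine ContinuousOn.congr (((continuousOn_impedance (γ := γ)).div continuousOn_id hne).div
      continuousOn_id hne) fun x hx => ?_
    rw [sqrt_deriv_pressure hγ hx]
    rfl
  have hmid : ρs / 2 ∈ Ioo 0 ρs :=
    ⟨half_pos (hρ.1.trans hρ.2), half_lt_self (hρ.1.trans hρ.2)⟩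
  have h := intervalIntegral.integral_hasDerivAt_right
    (hc.mono (ordConnected_Ioo.uIcc_subset hmid hρ)).intervalIntegrable
    (hc.stronglyMeasurableAtFilter isOpen_Ioo ρ hρ)
    (hc.continuousAt (Ioo_mem_nhds hρ.1 hρ.2))
  refine h.congr_deriv ?_
  rw [sqrt_deriv_pressure hγ hρ, div_div, sq]

lemma continuousOn_soundPotential (hγ : 0 < γ) :
    ContinuousOn (soundPotential γ ρs) (Ioo 0 ρs) := fun _ hρ =>
  (hasDerivAt_soundPotential hγ hρ).continuousAt.continuousWithinAt

lemma strictMonoOn_soundPotential (hγ : 0 < γ) : StrictMonoOn (soundPotential γ ρs) (Ioo 0 ρs) :=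
  strictMonoOn_Ioo_of_hasDerivAt_pos (fun _ => hasDerivAt_soundPotential hγ) fun _ hx =>
    div_pos (impedance_pos hγ hx) (pow_pos hx.1 2)

lemma hasDerivAt_speedPotential (hγ : 0 < γ) (hρ : ρ ∈ Ioo 0 ρs) :
    HasDerivAt (speedPotential γ ρs)
      ((γ + 1) / 2 * impedance γ ρs ρ / ((1 / ρ - 1 / ρs) * ρ ^ 2) / ρ) ρ := by
  have hρ₀ := hρ.1.ne'
  refine ((hasDerivAt_soundPotential hγ hρ).add
    ((hasDerivAt_impedance hρ).div (hasDerivAt_id' ρ) hρ₀)).congr_deriv ?_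
  generalize (γ + 1) / 2 * impedance γ ρs ρ / ((1 / ρ - 1 / ρs) * ρ ^ 2) = Z'
  field_simp
  ring

lemma speedPotential_deriv_pos (hγ : 0 < γ) (hρ : ρ ∈ Ioo 0 ρs) :
    0 < (γ + 1) / 2 * impedance γ ρs ρ / ((1 / ρ - 1 / ρs) * ρ ^ 2) / ρ :=
  div_pos (impedance_deriv_pos hγ hρ) hρ.1

lemma continuousOn_speedPotential (hγ : 0 < γ) :
    ContinuousOn (speedPotential γ ρs) (Ioo 0 ρs) := fun _ hρ =>
  (hasDerivAt_speedPotential hγ hρ).continuousAt.continuousWithinAt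

lemma strictMonoOn_speedPotential (hγ : 0 < γ) : StrictMonoOn (speedPotential γ ρs) (Ioo 0 ρs) :=
  strictMonoOn_Ioo_of_hasDerivAt_pos (fun _ => hasDerivAt_speedPotential hγ)
    fun _ => speedPotential_deriv_pos hγ

lemma soundPotential_lt_speedPotential (hγ : 0 < γ) (hρ : ρ ∈ Ioo 0 ρs) :
    soundPotential γ ρs ρ < speedPotential γ ρs ρ :=
  lt_add_of_pos_right _ (div_pos (impedance_pos hγ hρ) hρ.1)

lemma tendsto_speedPotential_atTop (hγ : 0 < γ) (hρs : 0 < ρs) :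
    Tendsto (speedPotential γ ρs) (𝓝[<] ρs) atTop := by
  have hZ : Tendsto (impedance γ ρs) (𝓝[<] ρs) atTop :=
    ((tendsto_rpow_neg_nhdsGT_zero (by linarith)).comp
      (tendsto_specificVolume_excess_right hρs)).const_mul_atTop (Real.sqrt_pos.2 hγ)
  refine tendsto_atTop_mono' _ ?_ (tendsto_atTop_add_const_left _ (soundPotential γ ρs (ρs / 2))
    (hZ.atTop_div_const hρs))
  filter_upwards [Ioo_mem_nhdsLT (half_lt_self hρs)] with x hx
  have hx' : x ∈ Ioo 0 ρs := ⟨(half_pos hρs).trans hx.1, hx.2⟩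
  exact add_le_add
    ((strictMonoOn_soundPotential hγ).monotoneOn ⟨half_pos hρs, half_lt_self hρs⟩ hx' hx.1.le)
    (div_le_div_of_nonneg_left (impedance_pos hγ hx').le hx'.1 hx.2.le)

/-! ### Slopes with respect to the specific volume -/

lemma exists_sub_eq_mul_specificVolume_sub {f g : ℝ → ℝ} (ha : 0 < a) (hab : a < b)
    (hf : ∀ x ∈ Icc a b, HasDerivAt f (g x / x ^ 2) x) :
    ∃ c ∈ Ioo a b, f b - f a = g c * (1 / a - 1 / b) := by
  have hpos : ∀ x ∈ Icc a b, 0 < x := fun x hx => ha.trans_le hx.1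
  have hv : ∀ x ∈ Icc a b, HasDerivAt (fun x : ℝ => -(1 / x)) (1 / x ^ 2) x := fun x hx => by
    simpa [one_div] using (hasDerivAt_inv (hpos x hx).ne').fun_neg
  obtain ⟨c, hc, h⟩ := exists_ratio_hasDerivAt_eq_ratio_slope f (fun x => g x / x ^ 2) hab
    (fun x hx => (hf x hx).continuousAt.continuousWithinAt)
    (fun x hx => hf x (Ioo_subset_Icc_self hx))
    (fun x => -(1 / x)) (fun x => 1 / x ^ 2)
    (fun x hx => (hv x hx).continuousAt.continuousWithinAt)
    (fun x hx => hv x (Ioo_subset_Icc_self hx))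
  refine ⟨c, hc, ?_⟩
  have hc₀ := hpos c (Ioo_subset_Icc_self hc)
  have hb₀ := ha.trans hab
  field_simp at h ⊢
  linarith

lemma impedance_mul_lt_soundPotential_sub (hγ : 0 < γ) (ha : 0 < a) (hab : a < b) (hb : b < ρs) :
    impedance γ ρs a * (1 / a - 1 / b) < soundPotential γ ρs b - soundPotential γ ρs a := by
  obtain ⟨c, hc, h⟩ := exists_sub_eq_mul_specificVolume_sub ha hab fun x hx =>
    hasDerivAt_soundPotential hγ (⟨ha.trans_le hx.1, hx.2.trans_lt hb⟩ : x ∈ Ioo 0 ρs)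
  rw [h]
  exact mul_lt_mul_of_pos_right
    (strictMonoOn_impedance hγ ⟨ha, hab.trans hb⟩ ⟨ha.trans hc.1, hc.2.trans hb⟩ hc.1)
    (sub_pos.2 (one_div_lt_one_div_of_lt ha hab))

lemma pressure_sub_bounds (hγ : 0 < γ) (ha : 0 < a) (hab : a < b) (hb : b < ρs) :
    impedance γ ρs a ^ 2 * (1 / a - 1 / b) < pressure γ ρs b - pressure γ ρs a ∧
      pressure γ ρs b - pressure γ ρs a < impedance γ ρs b ^ 2 * (1 / a - 1 / b) := by
  obtain ⟨c, hc, h⟩ := exists_sub_eq_mul_specificVolume_sub ha hab fun x hx =>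
    hasDerivAt_pressure hγ (⟨ha.trans_le hx.1, hx.2.trans_lt hb⟩ : x ∈ Ioo 0 ρs)
  have haI : a ∈ Ioo 0 ρs := ⟨ha, hab.trans hb⟩
  have hcI : c ∈ Ioo 0 ρs := ⟨ha.trans hc.1, hc.2.trans hb⟩
  have hZ := strictMonoOn_impedance (ρs := ρs) hγ
  have hv : 0 < 1 / a - 1 / b := sub_pos.2 (one_div_lt_one_div_of_lt ha hab)
  rw [h]
  exact ⟨mul_lt_mul_of_pos_right
      (pow_lt_pow_left₀ (hZ haI hcI hc.1) (impedance_pos hγ haI).le two_ne_zero) hv,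
    mul_lt_mul_of_pos_right
      (pow_lt_pow_left₀ (hZ hcI ⟨ha.trans hab, hb⟩ hc.2) (impedance_pos hγ hcI).le two_ne_zero) hv⟩

lemma two_mul_soundPotential_sub_le {c : ℝ} (hγ : 0 < γ) (hc : 0 < c) (ha : 0 < a) (hab : a ≤ b)
    (hb : b < ρs) :
    2 * (soundPotential γ ρs b - soundPotential γ ρs a) ≤
      c * (pressure γ ρs b - pressure γ ρs a) + c⁻¹ * (1 / a - 1 / b) := by
  obtain rfl | hab := hab.eq_or_lt
  · simp
  obtain ⟨x, -, hx⟩ := exists_sub_eq_mul_specificVolume_sub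
    (f := fun x => c * pressure γ ρs x - 2 * soundPotential γ ρs x)
    (g := fun x => c * impedance γ ρs x ^ 2 - 2 * impedance γ ρs x) ha hab fun x hx => by
      have hxI : x ∈ Ioo 0 ρs := ⟨ha.trans_le hx.1, hx.2.trans_lt hb⟩
      exact (((hasDerivAt_pressure hγ hxI).const_mul c).sub
        ((hasDerivAt_soundPotential hγ hxI).const_mul 2)).congr_deriv (by ring)
  have hv : 0 < 1 / a - 1 / b := sub_pos.2 (one_div_lt_one_div_of_lt ha hab)
  have hsq : c * impedance γ ρs x ^ 2 - 2 * impedance γ ρs x + c⁻¹ =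
      c * (impedance γ ρs x - c⁻¹) ^ 2 := by
    field_simp
    ring
  have := mul_nonneg (hsq.symm ▸ mul_nonneg hc.le (sq_nonneg _) :
    0 ≤ c * impedance γ ρs x ^ 2 - 2 * impedance γ ρs x + c⁻¹) hv.le
  linarith

/-! ### The vacuum limit of the potentials -/

/-- The limit of `P` at the vacuum. It is finite exactly when `P` is bounded below on `(0, ρ*)`;
otherwise the infimum has the junk value `0`. -/
noncomputable def vacuumPotential (γ ρs : ℝ) : ℝ := sInf (soundPotential γ ρs '' Ioo 0 ρs)

lemma speedPotential_lt_soundPotential_add (hγ : 0 < γ) (ha : 0 < a) (hab : a < b) (hb : b < ρs) :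
    speedPotential γ ρs a < soundPotential γ ρs b + impedance γ ρs a / b := by
  have h := impedance_mul_lt_soundPotential_sub hγ ha hab hb
  rw [mul_sub, mul_one_div, mul_one_div] at h
  rw [speedPotential]
  linarith

lemma tendsto_soundPotential_add_impedance_div (hγ : 0 < γ) (m : ℝ) :
    Tendsto (fun ρ => soundPotential γ ρs m + impedance γ ρs ρ / m) (𝓝[>] 0)
      (𝓝 (soundPotential γ ρs m)) := by
  simpa using ((tendsto_impedance_zero hγ).div_const m).const_add (soundPotential γ ρs m)

lemma le_soundPotential_of_le_speedPotential {c K m : ℝ} (hγ : 0 < γ) (hc : 0 < c)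
    (hK : ∀ ρ ∈ Ioo 0 c, K ≤ speedPotential γ ρs ρ) (hm : m ∈ Ioo 0 ρs) :
    K ≤ soundPotential γ ρs m := by
  refine ge_of_tendsto (tendsto_soundPotential_add_impedance_div hγ m) ?_
  filter_upwards [Ioo_mem_nhdsGT (lt_min hc hm.1)] with ρ hρ
  exact (hK ρ ⟨hρ.1, hρ.2.trans_le (min_le_left _ _)⟩).trans
    (speedPotential_lt_soundPotential_add hγ hρ.1 (hρ.2.trans_le (min_le_right _ _)) hm.2).le

lemma bddBelow_soundPotential_of_le_speedPotential {c K : ℝ} (hγ : 0 < γ) (hc : 0 < c)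
    (hK : ∀ ρ ∈ Ioo 0 c, K ≤ speedPotential γ ρs ρ) :
    BddBelow (soundPotential γ ρs '' Ioo 0 ρs) :=
  ⟨K, forall_mem_image.2 fun _ => le_soundPotential_of_le_speedPotential hγ hc hK⟩

lemma le_vacuumPotential_of_le_speedPotential {c K : ℝ} (hγ : 0 < γ) (hρs : 0 < ρs) (hc : 0 < c)
    (hK : ∀ ρ ∈ Ioo 0 c, K ≤ speedPotential γ ρs ρ) : K ≤ vacuumPotential γ ρs :=
  le_csInf ((nonempty_Ioo.2 hρs).image _) <|
    forall_mem_image.2 fun _ => le_soundPotential_of_le_speedPotential hγ hc hK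

section BddBelow

variable (hbdd : BddBelow (soundPotential γ ρs '' Ioo 0 ρs))

include hbdd

lemma vacuumPotential_lt_soundPotential (hγ : 0 < γ) (hρ : ρ ∈ Ioo 0 ρs) :
    vacuumPotential γ ρs < soundPotential γ ρs ρ := by
  have hρ₂ : ρ / 2 ∈ Ioo 0 ρs := ⟨half_pos hρ.1, (half_lt_self hρ.1).trans hρ.2⟩
  exact (csInf_le hbdd (mem_image_of_mem _ hρ₂)).trans_lt
    (strictMonoOn_soundPotential hγ hρ₂ hρ (half_lt_self hρ.1))

lemma tendsto_soundPotential_zero (hγ : 0 < γ) (hρs : 0 < ρs) :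
    Tendsto (soundPotential γ ρs) (𝓝[>] 0) (𝓝 (vacuumPotential γ ρs)) :=
  (strictMonoOn_soundPotential hγ).monotoneOn.tendsto_nhdsWithin_Ioo_right
    (nonempty_Ioo.2 hρs) hbdd

lemma tendsto_speedPotential_zero (hγ : 0 < γ) (hρs : 0 < ρs) :
    Tendsto (speedPotential γ ρs) (𝓝[>] 0) (𝓝 (vacuumPotential γ ρs)) := by
  refine tendsto_order.2 ⟨fun K hK => ?_, fun K hK => ?_⟩
  · filter_upwards [Ioo_mem_nhdsGT hρs] with ρ hρ
    exact hK.trans ((vacuumPotential_lt_soundPotential hbdd hγ hρ).trans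
      (soundPotential_lt_speedPotential hγ hρ))
  · obtain ⟨_, ⟨m, hm, rfl⟩, hmK⟩ := exists_lt_of_csInf_lt ((nonempty_Ioo.2 hρs).image _) hK
    filter_upwards [Ioo_mem_nhdsGT hm.1,
      (tendsto_soundPotential_add_impedance_div hγ m).eventually_lt_const hmK] with ρ hρ hρK
    exact (speedPotential_lt_soundPotential_add hγ hρ.1 hρ.2 hm.2).trans hρK

lemma continuousOn_update_speedPotential (hγ : 0 < γ) (hρs : 0 < ρs) :
    ContinuousOn (Function.update (speedPotential γ ρs) 0 (vacuumPotential γ ρs)) (Ico 0 ρs) := by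
  rw [continuousOn_update_iff, Ico_sdiff_left]
  exact ⟨continuousOn_speedPotential hγ, fun _ =>
    (tendsto_speedPotential_zero hbdd hγ hρs).mono_left (nhdsWithin_mono _ Ioo_subset_Ioi_self)⟩

end BddBelow

/-! ### Velocity jumps across waves -/

variable {ε D : ℝ}

/-- The squared velocity jump, divided by `ε`, that the Rankine-Hugoniot conditions impose across a
discontinuity between the densities `a` and `b`. -/
noncomputable def shockStrength (γ ρs a b : ℝ) : ℝ :=
  (1 / a - 1 / b) * (pressure γ ρs b - pressure γ ρs a)

lemma shockStrength_comm (γ ρs a b : ℝ) : shockStrength γ ρs a b = shockStrength γ ρs b a := by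
  simp only [shockStrength]
  ring

lemma shockStrength_nonneg (hγ : 0 < γ) (ha : 0 < a) (hab : a ≤ b) (hb : b < ρs) :
    0 ≤ shockStrength γ ρs a b :=
  mul_nonneg (sub_nonneg.2 (one_div_le_one_div_of_le ha hab)) <| sub_nonneg.2 <|
    (strictMonoOn_pressure hγ).monotoneOn ⟨ha, hab.trans_lt hb⟩ ⟨ha.trans_le hab, hb⟩ hab

lemma shockStrength_lt_shockStrength {a' b' : ℝ} (hγ : 0 < γ) (ha' : 0 < a') (ha : a' ≤ a)
    (hab : a ≤ b) (hb : b ≤ b') (hb' : b' < ρs) (hne : a' < a ∨ b < b') :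
    shockStrength γ ρs a b < shockStrength γ ρs a' b' := by
  have ha₀ := ha'.trans_le ha
  have hb₀ := ha₀.trans_le hab
  have hp := strictMonoOn_pressure (ρs := ρs) hγ
  have ha'I : a' ∈ Ioo 0 ρs := ⟨ha', (ha.trans (hab.trans hb)).trans_lt hb'⟩
  have haI : a ∈ Ioo 0 ρs := ⟨ha₀, (hab.trans hb).trans_lt hb'⟩
  have hbI : b ∈ Ioo 0 ρs := ⟨hb₀, hb.trans_lt hb'⟩
  have hb'I : b' ∈ Ioo 0 ρs := ⟨hb₀.trans_le hb, hb'⟩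
  have hv := one_div_le_one_div_of_le ha₀ hab
  have hpab := hp.monotoneOn haI hbI hab
  refine mul_lt_mul'' ?_ ?_ (sub_nonneg.2 hv) (sub_nonneg.2 hpab)
  · have hva := one_div_le_one_div_of_le ha' ha
    have hvb := one_div_le_one_div_of_le hb₀ hb
    rcases hne with h | h
    · linarith [one_div_lt_one_div_of_lt ha' h]
    · linarith [one_div_lt_one_div_of_lt hb₀ h]
  · have hpa := hp.monotoneOn ha'I haI ha
    have hpb := hp.monotoneOn hbI hb'I hb
    rcases hne with h | h
    · linarith [hp ha'I haI h]
    · linarith [hp hbI hb'I h]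

/-- Up to the sign of the family, the velocity jump from the density `a` to the density `ρ` along
the wave curve of nature `w` issued from a state of density `a`. -/
noncomputable def velocityJump (γ ρs ε : ℝ) (w : WaveKind) (a ρ : ℝ) : ℝ :=
  match w with
  | .shock => Real.sign (ρ - a) * √(ε * shockStrength γ ρs a ρ)
  | .rarefaction => √ε * (soundPotential γ ρs ρ - soundPotential γ ρs a)

lemma waveCurve_zero (γ ρs ε : ℝ) (k : Family) (w : WaveKind) (v : ℝ × ℝ) :
    waveCurve γ ρs ε k w v 0 = 0 := by
  cases w <;> simp [waveCurve, hugoniotCurve, integralCurve]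

lemma waveCurve_eq (k : Family) (w : WaveKind) {v : ℝ × ℝ} (hv : 0 < v.1) (hρ : 0 < ρ) :
    waveCurve γ ρs ε k w v ρ = ρ * (v.2 / v.1 + k.sgn * velocityJump γ ρs ε w v.1 ρ) := by
  cases w with
  | shock =>
    have h : √(ρ / v.1) * √((ρ - v.1) * (ε * pressure γ ρs ρ - ε * pressure γ ρs v.1)) =
        ρ * √(ε * shockStrength γ ρs v.1 ρ) := by
      rw [← Real.sqrt_mul (by positivity), ← Real.sqrt_sq hρ.le, ← Real.sqrt_mul (sq_nonneg _),
        Real.sqrt_sq hρ.le, shockStrength]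
      congr 1
      field_simp
    simp only [waveCurve, hugoniotCurve, velocityJump]
    rw [h]
    ring
  | rarefaction =>
    simp only [waveCurve, integralCurve, velocityJump]
    ring

lemma velocityJump_self (γ ρs ε : ℝ) (w : WaveKind) (a : ℝ) : velocityJump γ ρs ε w a a = 0 := by
  cases w <;> simp [velocityJump]

lemma velocityJump_shock_of_le (h : a ≤ ρ) :
    velocityJump γ ρs ε .shock a ρ = √(ε * shockStrength γ ρs a ρ) := by
  obtain rfl | h := h.eq_or_lt
  · simp [velocityJump, shockStrength]
  · rw [velocityJump, Real.sign_of_pos (sub_pos.2 h), one_mul]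

lemma velocityJump_shock_of_ge (h : ρ ≤ a) :
    velocityJump γ ρs ε .shock a ρ = -√(ε * shockStrength γ ρs ρ a) := by
  obtain rfl | h := h.eq_or_lt
  · simp [velocityJump, shockStrength]
  · rw [velocityJump, Real.sign_of_neg (sub_neg.2 h), neg_one_mul, shockStrength_comm]

lemma strictMonoOn_velocityJump_shock (hγ : 0 < γ) (hε : 0 < ε) (ha : a ∈ Ioo 0 ρs) :
    StrictMonoOn (velocityJump γ ρs ε .shock a) (Ioo 0 ρs) := by
  have hleft : StrictMonoOn (velocityJump γ ρs ε .shock a) (Ioc 0 a) := fun x hx y hy hxy => by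
    rw [velocityJump_shock_of_ge hx.2, velocityJump_shock_of_ge hy.2, neg_lt_neg_iff]
    exact Real.sqrt_lt_sqrt (mul_nonneg hε.le (shockStrength_nonneg hγ hy.1 hy.2 ha.2))
      (mul_lt_mul_of_pos_left (shockStrength_lt_shockStrength hγ hx.1 hxy.le hy.2 le_rfl ha.2
        (.inl hxy)) hε)
  have hright : StrictMonoOn (velocityJump γ ρs ε .shock a) (Ico a ρs) := fun x hx y hy hxy => by
    rw [velocityJump_shock_of_le hx.1, velocityJump_shock_of_le hy.1]
    exact Real.sqrt_lt_sqrt (mul_nonneg hε.le (shockStrength_nonneg hγ ha.1 hx.1 hx.2))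
      (mul_lt_mul_of_pos_left (shockStrength_lt_shockStrength hγ ha.1 le_rfl hx.1 hxy.le hy.2
        (.inr hxy)) hε)
  simpa only [Ioc_union_Ico_eq_Ioo ha.1 ha.2] using
    hleft.union hright (isGreatest_Ioc ha.1) (isLeast_Ico ha.2)

lemma strictMonoOn_velocityJump (w : WaveKind) (hγ : 0 < γ) (hε : 0 < ε) (ha : a ∈ Ioo 0 ρs) :
    StrictMonoOn (velocityJump γ ρs ε w a) (Ioo 0 ρs) := by
  cases w with
  | shock => exact strictMonoOn_velocityJump_shock hγ hε ha
  | rarefaction =>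
    exact fun x hx y hy hxy => mul_lt_mul_of_pos_left
      (sub_lt_sub_right (strictMonoOn_soundPotential hγ hx hy hxy) _) (Real.sqrt_pos.2 hε)

lemma continuousOn_velocityJump_shock (hγ : 0 < γ) (ha : 0 < a) :
    ContinuousOn (velocityJump γ ρs ε .shock a) (Ico a ρs) := by
  have hpos : ∀ x ∈ Ico a ρs, x ∈ Ioo 0 ρs := fun x hx => ⟨ha.trans_le hx.1, hx.2⟩
  have h : ContinuousOn (shockStrength γ ρs a) (Ico a ρs) :=
    (continuousOn_const.sub
      (continuousOn_const.div continuousOn_id fun x hx => (hpos x hx).1.ne')).mul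
      (((continuousOn_pressure hγ).mono hpos).sub continuousOn_const)
  exact (continuousOn_const.mul h).sqrt.congr fun x hx => velocityJump_shock_of_le hx.1

lemma continuousOn_velocityJump_rarefaction (hγ : 0 < γ) :
    ContinuousOn (velocityJump γ ρs ε .rarefaction a) (Ioo 0 ρs) :=
  continuousOn_const.mul ((continuousOn_soundPotential hγ).sub continuousOn_const)

lemma tendsto_velocityJump_shock_atTop (hγ : 0 < γ) (hε : 0 < ε) (ha : a ∈ Ioo 0 ρs) :
    Tendsto (velocityJump γ ρs ε .shock a) (𝓝[<] ρs) atTop := by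
  have hρs := ha.1.trans ha.2
  have hv : Tendsto (fun ρ => 1 / a - 1 / ρ) (𝓝[<] ρs) (𝓝 (1 / a - 1 / ρs)) :=
    (tendsto_const_nhds.sub (tendsto_const_nhds.div tendsto_id hρs.ne')).mono_left
      nhdsWithin_le_nhds
  have hS := (hv.pos_mul_atTop (specificVolume_excess_pos ha) (tendsto_atTop_add_const_right _
    (-pressure γ ρs a) (tendsto_pressure_atTop hγ hρs))).const_mul_atTop hε
  refine (Real.tendsto_sqrt_atTop.comp hS).congr' ?_
  filter_upwards [Ioo_mem_nhdsLT ha.2] with ρ hρ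
  rw [velocityJump_shock_of_le hρ.1.le, Function.comp_apply, shockStrength,
    sub_eq_add_neg (pressure γ ρs ρ)]

/-- A wave of nature `w` goes from the density `a` to the density `ρ`, the first density being the
one on the left for the first family and on the right for the second. -/
def IsAdmissibleJump (w : WaveKind) (a ρ : ℝ) : Prop :=
  match w with
  | .shock => a < ρ
  | .rarefaction => ρ < a

lemma IsAdmissibleJump.unique {w w' : WaveKind} (h : IsAdmissibleJump w a ρ)
    (h' : IsAdmissibleJump w' a ρ) : w = w' := by
  cases w <;> cases w' <;> first | rfl | exact (lt_asymm h h').elim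

lemma IsAdmissibleJump.ne {w : WaveKind} (h : IsAdmissibleJump w a ρ) : ρ ≠ a := by
  cases w
  exacts [(show a < ρ from h).ne', (show ρ < a from h).ne]

/-- The velocity jump along the composite wave curve, made of the states that the admissible wave,
of one nature or the other, joins to a state of density `a`. -/
noncomputable def compositeJump (γ ρs ε a ρ : ℝ) : ℝ :=
  if ρ ≤ a then velocityJump γ ρs ε .rarefaction a ρ else velocityJump γ ρs ε .shock a ρ

lemma compositeJump_of_le (h : ρ ≤ a) :
    compositeJump γ ρs ε a ρ = velocityJump γ ρs ε .rarefaction a ρ := if_pos h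

lemma compositeJump_of_ge (h : a ≤ ρ) :
    compositeJump γ ρs ε a ρ = velocityJump γ ρs ε .shock a ρ := by
  obtain rfl | h := h.eq_or_lt
  · rw [compositeJump_of_le le_rfl, velocityJump_self, velocityJump_self]
  · exact if_neg h.not_ge

lemma IsAdmissibleJump.compositeJump_eq {w : WaveKind} (h : IsAdmissibleJump w a ρ) :
    compositeJump γ ρs ε a ρ = velocityJump γ ρs ε w a ρ := by
  cases w
  exacts [compositeJump_of_ge (le_of_lt h), compositeJump_of_le (le_of_lt h)]

lemma compositeJump_self (γ ρs ε a : ℝ) : compositeJump γ ρs ε a a = 0 := by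
  rw [compositeJump_of_le le_rfl, velocityJump_self]

lemma compositeJump_eq_add (γ ρs ε a ρ : ℝ) :
    compositeJump γ ρs ε a ρ =
      velocityJump γ ρs ε .rarefaction a (min ρ a) + velocityJump γ ρs ε .shock a (max ρ a) := by
  rcases le_total ρ a with h | h
  · rw [min_eq_left h, max_eq_right h, velocityJump_self, add_zero, compositeJump_of_le h]
  · rw [min_eq_right h, max_eq_left h, velocityJump_self, zero_add, compositeJump_of_ge h]

lemma strictMonoOn_compositeJump (hγ : 0 < γ) (hε : 0 < ε) (ha : a ∈ Ioo 0 ρs) :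
    StrictMonoOn (compositeJump γ ρs ε a) (Ioo 0 ρs) := by
  have hleft : StrictMonoOn (compositeJump γ ρs ε a) (Ioc 0 a) :=
    ((strictMonoOn_velocityJump .rarefaction hγ hε ha).mono fun x hx =>
      ⟨hx.1, hx.2.trans_lt ha.2⟩).congr fun x hx => (compositeJump_of_le hx.2).symm
  have hright : StrictMonoOn (compositeJump γ ρs ε a) (Ico a ρs) :=
    ((strictMonoOn_velocityJump .shock hγ hε ha).mono fun x hx =>
      ⟨ha.1.trans_le hx.1, hx.2⟩).congr fun x hx => (compositeJump_of_ge hx.1).symm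
  simpa only [Ioc_union_Ico_eq_Ioo ha.1 ha.2] using
    hleft.union hright (isGreatest_Ioc ha.1) (isLeast_Ico ha.2)

lemma continuousOn_compositeJump (hγ : 0 < γ) (ha : a ∈ Ioo 0 ρs) :
    ContinuousOn (compositeJump γ ρs ε a) (Ioo 0 ρs) := by
  refine ContinuousOn.congr (ContinuousOn.add ?_ ?_) fun ρ _ => compositeJump_eq_add γ ρs ε a ρ
  · exact (continuousOn_velocityJump_rarefaction hγ).comp
      (continuous_id.min continuous_const).continuousOn
      fun ρ hρ => ⟨lt_min hρ.1 ha.1, min_lt_of_left_lt hρ.2⟩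
  · exact (continuousOn_velocityJump_shock hγ ha.1).comp
      (continuous_id.max continuous_const).continuousOn
      fun ρ hρ => ⟨le_max_right _ _, max_lt hρ.2 ha.2⟩

lemma tendsto_compositeJump_atTop (hγ : 0 < γ) (hε : 0 < ε) (ha : a ∈ Ioo 0 ρs) :
    Tendsto (compositeJump γ ρs ε a) (𝓝[<] ρs) atTop := by
  refine (tendsto_velocityJump_shock_atTop hγ hε ha).congr' ?_
  filter_upwards [Ioo_mem_nhdsLT ha.2] with ρ hρ using (compositeJump_of_ge hρ.1.le).symm

section Comparison

variable (hγ : 0 < γ) (hε : 0 < ε) (ha : a ∈ Ioo 0 ρs) (hρ : ρ ∈ Ioo 0 ρs)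

include hγ hε ha hρ

lemma velocityJump_nonpos (w : WaveKind) (h : ρ ≤ a) : velocityJump γ ρs ε w a ρ ≤ 0 :=
  velocityJump_self γ ρs ε w a ▸ (strictMonoOn_velocityJump w hγ hε ha).monotoneOn hρ ha h

lemma compositeJump_pos_iff : 0 < compositeJump γ ρs ε a ρ ↔ a < ρ := by
  simpa only [compositeJump_self] using (strictMonoOn_compositeJump hγ hε ha).lt_iff_lt ha hρ

lemma compositeJump_neg_iff : compositeJump γ ρs ε a ρ < 0 ↔ ρ < a := by
  simpa only [compositeJump_self] using (strictMonoOn_compositeJump hγ hε ha).lt_iff_lt hρ ha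

lemma compositeJump_lt_iff (hD : 0 < D) :
    compositeJump γ ρs ε a ρ < D ↔ velocityJump γ ρs ε .shock a ρ < D := by
  rcases le_total ρ a with h | h
  · rw [compositeJump_of_le h]
    exact iff_of_true ((velocityJump_nonpos hγ hε ha hρ _ h).trans_lt hD)
      ((velocityJump_nonpos hγ hε ha hρ _ h).trans_lt hD)
  · rw [compositeJump_of_ge h]

lemma lt_compositeJump_iff (hD : 0 ≤ D) :
    D < compositeJump γ ρs ε a ρ ↔ D < velocityJump γ ρs ε .shock a ρ := by
  rcases le_total ρ a with h | h
  · rw [compositeJump_of_le h]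
    exact iff_of_false ((velocityJump_nonpos hγ hε ha hρ _ h).trans hD).not_gt
      ((velocityJump_nonpos hγ hε ha hρ _ h).trans hD).not_gt
  · rw [compositeJump_of_ge h]

lemma lt_compositeJump_of_lt_rarefaction (hD : D < 0)
    (h : D < velocityJump γ ρs ε .rarefaction a ρ) : D < compositeJump γ ρs ε a ρ := by
  rcases le_or_gt ρ a with h' | h'
  · rwa [compositeJump_of_le h']
  · exact hD.trans ((compositeJump_pos_iff hγ hε ha hρ).2 h')

lemma compositeJump_swap_lt (hD : 0 ≤ D) (h : D < compositeJump γ ρs ε a ρ) :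
    compositeJump γ ρs ε ρ a < D :=
  ((compositeJump_neg_iff hγ hε hρ ha).2 <|
    (compositeJump_pos_iff hγ hε ha hρ).1 (hD.trans_lt h)).trans_le hD

lemma mul_vacuumPotential_sub_lt_compositeJump (hbdd : BddBelow (soundPotential γ ρs '' Ioo 0 ρs)) :
    √ε * (vacuumPotential γ ρs - soundPotential γ ρs a) < compositeJump γ ρs ε a ρ := by
  rcases le_or_gt ρ a with h | h
  · rw [compositeJump_of_le h]
    exact mul_lt_mul_of_pos_left (sub_lt_sub_right (vacuumPotential_lt_soundPotential hbdd hγ hρ) _)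
      (Real.sqrt_pos.2 hε)
  · exact (mul_neg_of_pos_of_neg (Real.sqrt_pos.2 hε)
      (sub_neg.2 (vacuumPotential_lt_soundPotential hbdd hγ ha))).trans
      ((compositeJump_pos_iff hγ hε ha hρ).2 h)

end Comparison

/-- The velocity jump `u_ℓ - u_r` of the Riemann problem with densities `a` and `b` whose
intermediate state has density `ρ`. -/
noncomputable def totalJump (γ ρs ε a b ρ : ℝ) : ℝ :=
  compositeJump γ ρs ε a ρ + compositeJump γ ρs ε b ρ

lemma totalJump_left (γ ρs ε a b : ℝ) : totalJump γ ρs ε a b a = compositeJump γ ρs ε b a := by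
  rw [totalJump, compositeJump_self, zero_add]

lemma totalJump_right (γ ρs ε a b : ℝ) : totalJump γ ρs ε a b b = compositeJump γ ρs ε a b := by
  rw [totalJump, compositeJump_self, add_zero]

section TotalJump

variable (hγ : 0 < γ) (hε : 0 < ε) (ha : a ∈ Ioo 0 ρs) (hb : b ∈ Ioo 0 ρs)

include hγ hε ha hb

lemma strictMonoOn_totalJump : StrictMonoOn (totalJump γ ρs ε a b) (Ioo 0 ρs) :=
  (strictMonoOn_compositeJump hγ hε ha).add (strictMonoOn_compositeJump hγ hε hb)

lemma exists_totalJump_eq {x : ℝ} (hx : x ∈ Ioo 0 ρs) (hD : totalJump γ ρs ε a b x ≤ D) :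
    ∃ ρ ∈ Ico x ρs, totalJump γ ρs ε a b ρ = D := by
  have hcont : ContinuousOn (totalJump γ ρs ε a b) (Ioo 0 ρs) :=
    (continuousOn_compositeJump hγ ha).add (continuousOn_compositeJump hγ hb)
  have htop : Tendsto (totalJump γ ρs ε a b) (𝓝[<] ρs) atTop :=
    (tendsto_compositeJump_atTop hγ hε ha).atTop_add_atTop (tendsto_compositeJump_atTop hγ hε hb)
  obtain ⟨y, hDy, hxy, hyρs⟩ :=
    ((htop.eventually_ge_atTop D).and (Ioo_mem_nhdsLT hx.2)).exists
  obtain ⟨ρ, hρ, rfl⟩ := intermediate_value_Icc hxy.le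
    (hcont.mono fun z hz => ⟨hx.1.trans_le hz.1, hz.2.trans_lt hyρs⟩) ⟨hD, hDy⟩
  exact ⟨ρ, ⟨hρ.1, hρ.2.trans_lt hyρs⟩, rfl⟩

lemma exists_totalJump_le_of_not_bddBelow (D : ℝ)
    (hbdd : ¬BddBelow (soundPotential γ ρs '' Ioo 0 ρs)) :
    ∃ x ∈ Ioo 0 ρs, totalJump γ ρs ε a b x ≤ D := by
  by_contra! h
  have hs := Real.sqrt_pos.2 hε
  have hc : 0 < min a b := lt_min ha.1 hb.1
  refine hbdd (bddBelow_soundPotential_of_le_speedPotential (c := min a b)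
    (K := (D / √ε + soundPotential γ ρs a + soundPotential γ ρs b) / 2) hγ hc fun ρ hρ => ?_)
  have hρI : ρ ∈ Ioo 0 ρs := ⟨hρ.1, (hρ.2.trans_le (min_le_left _ _)).trans ha.2⟩
  have hD := h ρ hρI
  rw [totalJump, compositeJump_of_le (hρ.2.trans_le (min_le_left _ _)).le,
    compositeJump_of_le (hρ.2.trans_le (min_le_right _ _)).le, velocityJump, velocityJump,
    ← mul_add, ← div_lt_iff₀' hs] at hD
  linarith [soundPotential_lt_speedPotential hγ hρI]

lemma mul_vacuumPotential_sub_lt_totalJump (hρ : ρ ∈ Ioo 0 ρs)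
    (hbdd : BddBelow (soundPotential γ ρs '' Ioo 0 ρs)) :
    √ε * (2 * vacuumPotential γ ρs - soundPotential γ ρs a - soundPotential γ ρs b) <
      totalJump γ ρs ε a b ρ := by
  have hlt := add_lt_add (mul_vacuumPotential_sub_lt_compositeJump hγ hε ha hρ hbdd)
    (mul_vacuumPotential_sub_lt_compositeJump hγ hε hb hρ hbdd)
  rw [totalJump]
  linarith

end TotalJump

/-! ### Reflection -/

/-- The other characteristic family; the reflection `x ↦ -x` exchanges the two. -/
def Family.opposite : Family → Family
  | .first => .second
  | .second => .first

@[simp] lemma Family.sgn_opposite (k : Family) : k.opposite.sgn = -k.sgn := by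
  cases k <;> simp [Family.opposite, Family.sgn]

/-- The image of a state `(ρ, q)` under the reflection `x ↦ -x`. -/
def reflect (v : ℝ × ℝ) : ℝ × ℝ := (v.1, -v.2)

@[simp] lemma reflect_fst (v : ℝ × ℝ) : (reflect v).1 = v.1 := rfl

@[simp] lemma reflect_snd (v : ℝ × ℝ) : (reflect v).2 = -v.2 := rfl

@[simp] lemma reflect_reflect (v : ℝ × ℝ) : reflect (reflect v) = v := by simp [reflect]

lemma charSpeed_reflect (γ ρs ε : ℝ) (k : Family) (v : ℝ × ℝ) :
    charSpeed γ ρs ε k.opposite (reflect v) = -charSpeed γ ρs ε k v := by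
  simp only [charSpeed, reflect_fst, reflect_snd, Family.sgn_opposite]
  ring

/-! ### Shocks -/

variable {σ j : ℝ} {k : Family} {v L R : ℝ × ℝ}

lemma IsShock.reflect (h : IsShock γ ρs ε k σ L R) :
    IsShock γ ρs ε k.opposite (-σ) (reflect R) (reflect L) := by
  obtain ⟨hL, hR, hmass, hmom, hlaxR, hlaxL⟩ := h
  refine ⟨hR, hL, ?_, ?_, ?_, ?_⟩
  · simp only [reflect_fst, reflect_snd]
    linarith
  · simp only [momentumFlux, reflect_fst, reflect_snd, neg_sq] at hmom ⊢
    linarith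
  · rwa [charSpeed_reflect, neg_lt_neg_iff]
  · rwa [charSpeed_reflect, neg_lt_neg_iff]

lemma charSpeed_first_eq_of_massFlux (hγ : 0 < γ) (hε : 0 ≤ ε) (hv : v.1 ∈ Ioo 0 ρs)
    (hj : v.2 = v.1 * σ + j) :
    charSpeed γ ρs ε .first v = σ + (j - √ε * impedance γ ρs v.1) / v.1 := by
  have hv₀ := hv.1
  rw [charSpeed_eq _ hγ hε hv, hj, Family.sgn]
  field_simp
  ring

lemma momentumFlux_eq_of_massFlux (hρ : ρ ≠ 0) :
    momentumFlux γ ρs ε ρ (ρ * σ + j) =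
      ρ * σ ^ 2 + 2 * σ * j + j ^ 2 * (1 / ρ) + ε * pressure γ ρs ρ := by
  rw [momentumFlux]
  field_simp
  ring

/-- In the frame of the shock the momentum is the mass flux `j`, the same on both sides. -/
lemma isShock_first_iff_massFlux (hγ : 0 < γ) (hε : 0 ≤ ε) :
    IsShock γ ρs ε .first σ L R ↔
      L.1 ∈ Ioo 0 ρs ∧ R.1 ∈ Ioo 0 ρs ∧ ∃ j, L.2 = L.1 * σ + j ∧ R.2 = R.1 * σ + j ∧
        j ^ 2 * (1 / L.1 - 1 / R.1) = ε * (pressure γ ρs R.1 - pressure γ ρs L.1) ∧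
        √ε * impedance γ ρs L.1 < j ∧ j < √ε * impedance γ ρs R.1 := by
  refine and_congr_right fun hL => and_congr_right fun hR => ?_
  have hspeed : ∀ j, L.2 = L.1 * σ + j → R.2 = R.1 * σ + j →
      (charSpeed γ ρs ε .first R < σ ∧ σ < charSpeed γ ρs ε .first L ↔
        √ε * impedance γ ρs L.1 < j ∧ j < √ε * impedance γ ρs R.1) := fun j hjL hjR => by
    rw [charSpeed_first_eq_of_massFlux hγ hε hL hjL, charSpeed_first_eq_of_massFlux hγ hε hR hjR,
      add_lt_iff_neg_left, lt_add_iff_pos_right, div_pos_iff_of_pos_right hL.1, sub_pos,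
      div_neg_iff, sub_neg, and_iff_left hR.1, and_comm]
    simp [hR.1.le]
  have hflux : ∀ j, L.2 = L.1 * σ + j → R.2 = R.1 * σ + j →
      (momentumFlux γ ρs ε R.1 R.2 - momentumFlux γ ρs ε L.1 L.2 = σ * (R.2 - L.2) ↔
        j ^ 2 * (1 / L.1 - 1 / R.1) = ε * (pressure γ ρs R.1 - pressure γ ρs L.1)) :=
    fun j hjL hjR => by
      rw [hjL, hjR, momentumFlux_eq_of_massFlux hL.1.ne', momentumFlux_eq_of_massFlux hR.1.ne']
      constructor <;> intro h <;> linarith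
  constructor
  · rintro ⟨hmass, hmom, hlax⟩
    have hjL : L.2 = L.1 * σ + (L.2 - L.1 * σ) := by ring
    have hjR : R.2 = R.1 * σ + (L.2 - L.1 * σ) := by linarith
    exact ⟨_, hjL, hjR, (hflux _ hjL hjR).1 hmom, (hspeed _ hjL hjR).1 hlax⟩
  · rintro ⟨j, hjL, hjR, hmom, hlax⟩
    exact ⟨by rw [hjL, hjR]; ring, (hflux j hjL hjR).2 hmom, (hspeed j hjL hjR).2 hlax⟩

lemma velocity_eq_add_div_of_massFlux (hv : v.1 ≠ 0) (hj : v.2 = v.1 * σ + j) :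
    v.2 / v.1 = σ + j / v.1 := by
  rw [hj]
  field_simp

lemma IsShock.first_density_lt (hγ : 0 < γ) (hε : 0 ≤ ε) (h : IsShock γ ρs ε .first σ L R) :
    L.1 < R.1 := by
  obtain ⟨hL, hR, j, -, -, -, hjL, hjR⟩ := (isShock_first_iff_massFlux hγ hε).1 h
  exact ((strictMonoOn_impedance hγ).lt_iff_lt hL hR).1
    (lt_of_mul_lt_mul_left (hjL.trans hjR) (Real.sqrt_nonneg ε))

lemma velocityJump_shock_eq_of_massFlux (ha : 0 < a) (hab : a ≤ b) (hj : 0 ≤ j)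
    (hmom : j ^ 2 * (1 / a - 1 / b) = ε * (pressure γ ρs b - pressure γ ρs a)) :
    velocityJump γ ρs ε .shock a b = j * (1 / a - 1 / b) := by
  have hv : 0 ≤ 1 / a - 1 / b := sub_nonneg.2 (one_div_le_one_div_of_le ha hab)
  have hsq : ε * shockStrength γ ρs a b = (j * (1 / a - 1 / b)) ^ 2 := by
    rw [shockStrength, mul_left_comm, ← hmom]
    ring
  rw [velocityJump_shock_of_le hab, hsq, Real.sqrt_sq (mul_nonneg hj hv)]

lemma IsShock.first_velocity_eq (hγ : 0 < γ) (hε : 0 ≤ ε) (h : IsShock γ ρs ε .first σ L R) :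
    R.2 / R.1 = L.2 / L.1 - velocityJump γ ρs ε .shock L.1 R.1 := by
  have hlt := h.first_density_lt hγ hε
  obtain ⟨hL, hR, j, hjL, hjR, hmom, hlax, -⟩ := (isShock_first_iff_massFlux hγ hε).1 h
  have hj : 0 ≤ j := (mul_nonneg (Real.sqrt_nonneg ε) (impedance_pos hγ hL).le).trans hlax.le
  rw [velocityJump_shock_eq_of_massFlux hL.1 hlt.le hj hmom,
    velocity_eq_add_div_of_massFlux hL.1.ne' hjL, velocity_eq_add_div_of_massFlux hR.1.ne' hjR]
  ring

lemma IsShock.first_lt_velocity (hγ : 0 < γ) (hε : 0 ≤ ε) (h : IsShock γ ρs ε .first σ L R) :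
    σ < R.2 / R.1 := by
  obtain ⟨hL, hR, j, -, hjR, -, hlax, -⟩ := (isShock_first_iff_massFlux hγ hε).1 h
  rw [velocity_eq_add_div_of_massFlux hR.1.ne' hjR]
  exact lt_add_of_pos_right _ (div_pos
    ((mul_nonneg (Real.sqrt_nonneg ε) (impedance_pos hγ hL).le).trans_lt hlax) hR.1)

lemma exists_massFlux (hγ : 0 < γ) (hε : 0 < ε) (ha : 0 < a) (hab : a < b) (hb : b < ρs) :
    ∃ j, j ^ 2 * (1 / a - 1 / b) = ε * (pressure γ ρs b - pressure γ ρs a) ∧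
      √ε * impedance γ ρs a < j ∧ j < √ε * impedance γ ρs b := by
  have hv : 0 < 1 / a - 1 / b := sub_pos.2 (one_div_lt_one_div_of_lt ha hab)
  obtain ⟨hlo, hhi⟩ := pressure_sub_bounds hγ ha hab hb
  rw [← lt_div_iff₀ hv] at hlo
  rw [← div_lt_iff₀ hv] at hhi
  set m := (pressure γ ρs b - pressure γ ρs a) / (1 / a - 1 / b) with hm
  refine ⟨√ε * √m, ?_, mul_lt_mul_of_pos_left (Real.lt_sqrt_of_sq_lt hlo) (Real.sqrt_pos.2 hε),
    mul_lt_mul_of_pos_left ((Real.sqrt_lt' (impedance_pos hγ ⟨ha.trans hab, hb⟩)).2 hhi)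
      (Real.sqrt_pos.2 hε)⟩
  rw [mul_pow, Real.sq_sqrt hε.le, Real.sq_sqrt ((sq_nonneg _).trans hlo.le), mul_assoc, hm,
    div_mul_cancel₀ _ hv.ne']

lemma exists_isShock_first (hγ : 0 < γ) (hε : 0 < ε) (hL : 0 < L.1) (hlt : L.1 < R.1)
    (hR : R.1 < ρs) (h : R.2 / R.1 = L.2 / L.1 - velocityJump γ ρs ε .shock L.1 R.1) :
    ∃ σ, IsShock γ ρs ε .first σ L R := by
  have hR₀ := hL.trans hlt
  obtain ⟨j, hmom, hjL, hjR⟩ := exists_massFlux hγ hε hL hlt hR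
  have hj : 0 ≤ j :=
    (mul_nonneg (Real.sqrt_nonneg ε) (impedance_pos hγ ⟨hL, hlt.trans hR⟩).le).trans hjL.le
  rw [velocityJump_shock_eq_of_massFlux hL hlt.le hj hmom] at h
  refine ⟨L.2 / L.1 - j / L.1, (isShock_first_iff_massFlux hγ hε.le).2 ⟨⟨hL, hlt.trans hR⟩,
    ⟨hR₀, hR⟩, j, ?_, ?_, hmom, hjL, hjR⟩⟩
  · field_simp
    ring
  · rw [← mul_div_cancel₀ R.2 hR₀.ne', h]
    field_simp
    ring

/-! ### Rarefactions -/

section Rarefaction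

variable {ξ d C : ℝ} {U V : ℝ → ℝ × ℝ}

lemma sq_charSpeed_sub_velocity (k : Family) (hγ : 0 < γ) (hε : 0 ≤ ε) (hv : v.1 ∈ Ioo 0 ρs) :
    (charSpeed γ ρs ε k v - v.2 / v.1) ^ 2 = ε * (impedance γ ρs v.1 ^ 2 / v.1 ^ 2) := by
  have hk : k.sgn ^ 2 = 1 := by cases k <;> simp [Family.sgn]
  rw [charSpeed_eq k hγ hε hv, add_sub_cancel_left, mul_pow, mul_pow, hk, Real.sq_sqrt hε,
    div_pow, one_mul]

lemma hasDerivAt_const_div {t : ℝ} (x : ℝ) (ht : t ≠ 0) :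
    HasDerivAt (fun s : ℝ => x / s) (-(x / t ^ 2)) t := by
  simpa only [div_eq_mul_inv, mul_neg] using (hasDerivAt_inv ht).const_mul x

lemma SolvesEulerAt.exists_hasDerivAt
    (h : SolvesEulerAt γ ρs ε (fun s y => (U (y / s)).1) (fun s y => (U (y / s)).2) 1 ξ) :
    ∃ d, HasDerivAt (fun y => (U y).1) d ξ ∧ HasDerivAt (fun y => (U y).2) (ξ * d) ξ := by
  obtain ⟨ρt, d, qt, qx, fx, hρt, hρx, -, hqx, -, hmass, -⟩ := h
  simp only [div_one] at hρx hqx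
  have hρt' : HasDerivAt (fun s => (U (ξ / s)).1) (d * -(ξ / 1 ^ 2)) 1 :=
    HasDerivAt.comp (h₂ := fun y => (U y).1) 1 (by rwa [div_one])
      (hasDerivAt_const_div ξ one_ne_zero)
  refine ⟨d, hρx, hqx.congr_deriv ?_⟩
  linarith [hρt.unique hρt']

lemma solvesEulerAt_of_hasDerivAt {t x : ℝ} (hγ : 0 < γ) (hε : 0 ≤ ε) (ht : 0 < t)
    (hρ : (U (x / t)).1 ∈ Ioo 0 ρs) (hspeed : charSpeed γ ρs ε k (U (x / t)) = x / t)
    (h₁ : HasDerivAt (fun y => (U y).1) d (x / t))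
    (h₂ : HasDerivAt (fun y => (U y).2) (x / t * d) (x / t)) :
    SolvesEulerAt γ ρs ε (fun s y => (U (y / s)).1) (fun s y => (U (y / s)).2) t x := by
  have hx : HasDerivAt (fun y : ℝ => y / t) (1 / t) x := (hasDerivAt_id x).div_const t
  have ht' := hasDerivAt_const_div x ht.ne'
  have hρx := h₁.comp x hx
  have hqx := h₂.comp x hx
  have hflux := ((hqx.pow 2).div hρx hρ.1.ne').add
    (((hasDerivAt_pressure hγ hρ).comp x hρx).const_mul ε)
  refine ⟨_, _, _, _, _, h₁.comp t ht', hρx, h₂.comp t ht', hqx, hflux, ?_, ?_⟩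
  · field_simp
    ring
  · have hsq := sq_charSpeed_sub_velocity k hγ hε hρ
    rw [hspeed] at hsq
    have hρ₀ := hρ.1.ne'
    simp only [Function.comp_apply, Pi.pow_apply]
    generalize (U (x / t)).1 = ρ at *
    generalize (U (x / t)).2 = q at *
    have hp : ε * (impedance γ ρs ρ ^ 2 / ρ ^ 2 * (d * (1 / t))) =
        (x / t - q / ρ) ^ 2 * (d * (1 / t)) := by
      rw [hsq]
      ring
    rw [hp]
    field_simp
    ring

/-- Where the rays are characteristic, the momentum equation follows from the conservation of mass,
which for a self-similar function says `q' = ξ ρ'`. -/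
lemma isRarefaction_iff (hγ : 0 < γ) (hε : 0 ≤ ε) :
    IsRarefaction γ ρs ε k U a b L R ↔
      a < b ∧ ContinuousOn U (Icc a b) ∧ U a = L ∧ U b = R ∧
      ∀ ξ ∈ Ioo a b, (U ξ).1 ∈ Ioo 0 ρs ∧ charSpeed γ ρs ε k (U ξ) = ξ ∧
        ∃ d, HasDerivAt (fun y => (U y).1) d ξ ∧ HasDerivAt (fun y => (U y).2) (ξ * d) ξ := by
  refine and_congr_right fun _ => and_congr_right fun _ => and_congr_right fun _ =>
    and_congr_right fun _ => forall₂_congr fun ξ _ => and_congr_right fun hρ =>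
    and_congr_right fun hξ => ⟨fun h => (h 1 ξ one_pos (div_one ξ)).exists_hasDerivAt, ?_⟩
  rintro ⟨d, h₁, h₂⟩ t x ht rfl
  exact solvesEulerAt_of_hasDerivAt hγ hε ht hρ hξ h₁ h₂

lemma IsRarefaction.reflect (hγ : 0 < γ) (hε : 0 ≤ ε) (h : IsRarefaction γ ρs ε k U a b L R) :
    IsRarefaction γ ρs ε k.opposite (fun ξ => reflect (U (-ξ))) (-b) (-a) (reflect R)
      (reflect L) := by
  rw [isRarefaction_iff hγ hε] at h ⊢
  obtain ⟨hab, hc, rfl, rfl, h⟩ := h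
  refine ⟨neg_lt_neg hab, ?_, by rw [neg_neg], by rw [neg_neg], fun ξ hξ => ?_⟩
  · have hc' : ContinuousOn (fun ξ => U (-ξ)) (Icc (-b) (-a)) :=
      hc.comp continuousOn_neg fun x hx => ⟨by linarith [hx.2], by linarith [hx.1]⟩
    exact hc'.fst.prodMk hc'.snd.neg
  · obtain ⟨hρ, hspeed, d, h₁, h₂⟩ := h (-ξ) ⟨by linarith [hξ.2], by linarith [hξ.1]⟩
    refine ⟨hρ, by rw [charSpeed_reflect, hspeed, neg_neg], -d, ?_, ?_⟩
    · exact (h₁.comp ξ (hasDerivAt_neg ξ)).congr_deriv (by ring)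
    · exact (h₂.comp ξ (hasDerivAt_neg ξ)).neg.congr_deriv (by ring)

lemma IsRarefaction.congr (hγ : 0 < γ) (hε : 0 ≤ ε) (h : IsRarefaction γ ρs ε k U a b L R)
    (hUV : EqOn V U (Icc a b)) : IsRarefaction γ ρs ε k V a b L R := by
  rw [isRarefaction_iff hγ hε] at h ⊢
  obtain ⟨hab, hc, hL, hR, h⟩ := h
  refine ⟨hab, hc.congr hUV, (hUV (left_mem_Icc.2 hab.le)).trans hL,
    (hUV (right_mem_Icc.2 hab.le)).trans hR, fun ξ hξ => ?_⟩
  have hV : V =ᶠ[𝓝 ξ] U :=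
    (hUV.mono Ioo_subset_Icc_self).eventuallyEq_of_mem (Ioo_mem_nhds hξ.1 hξ.2)
  rw [hUV (Ioo_subset_Icc_self hξ)]
  obtain ⟨hρ, hspeed, d, h₁, h₂⟩ := h ξ hξ
  exact ⟨hρ, hspeed, d, h₁.congr_of_eventuallyEq (hV.fun_comp Prod.fst),
    h₂.congr_of_eventuallyEq (hV.fun_comp Prod.snd)⟩

/-- The Riemann invariant `u + √ε P` of the first family. -/
noncomputable def riemannInvariant (γ ρs ε : ℝ) (v : ℝ × ℝ) : ℝ :=
  v.2 / v.1 + √ε * soundPotential γ ρs v.1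

/-- The state of density `ρ` at which the Riemann invariant of the first family is `C`. -/
noncomputable def invariantState (γ ρs ε C ρ : ℝ) : ℝ × ℝ :=
  (ρ, ρ * (C - √ε * soundPotential γ ρs ρ))

lemma invariantState_riemannInvariant (γ ρs ε : ℝ) (hv : v.1 ≠ 0) :
    invariantState γ ρs ε (riemannInvariant γ ρs ε v) v.1 = v := by
  simp only [invariantState, riemannInvariant, add_sub_cancel_right, mul_div_cancel₀ _ hv]

lemma riemannInvariant_invariantState (γ ρs ε C : ℝ) (hρ : ρ ≠ 0) :
    riemannInvariant γ ρs ε (invariantState γ ρs ε C ρ) = C := by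
  simp only [invariantState, riemannInvariant, mul_div_cancel_left₀ _ hρ, sub_add_cancel]

lemma charSpeed_first_eq_riemannInvariant_sub (hγ : 0 < γ) (hε : 0 ≤ ε) (hv : v.1 ∈ Ioo 0 ρs) :
    charSpeed γ ρs ε .first v = riemannInvariant γ ρs ε v - √ε * speedPotential γ ρs v.1 := by
  rw [charSpeed_eq _ hγ hε hv]
  simp only [Family.sgn, riemannInvariant, speedPotential]
  ring

lemma hasDerivAt_invariantState_snd (hγ : 0 < γ) (hρ : ρ ∈ Ioo 0 ρs) :
    HasDerivAt (fun x => (invariantState γ ρs ε C x).2) (C - √ε * speedPotential γ ρs ρ) ρ := by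
  have hρ₀ := hρ.1
  refine ((hasDerivAt_id' ρ).mul
    (((hasDerivAt_soundPotential hγ hρ).const_mul √ε).const_sub C)).congr_deriv ?_
  simp only [speedPotential]
  field_simp
  ring

lemma continuousOn_invariantState (hγ : 0 < γ) :
    ContinuousOn (invariantState γ ρs ε C) (Ioo 0 ρs) :=
  continuousOn_id.prodMk fun _ hρ =>
    (hasDerivAt_invariantState_snd hγ hρ).continuousAt.continuousWithinAt

lemma hasDerivAt_riemannInvariant (hγ : 0 < γ) (hε : 0 ≤ ε) (hρ : (U ξ).1 ∈ Ioo 0 ρs)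
    (hspeed : charSpeed γ ρs ε .first (U ξ) = ξ) (h₁ : HasDerivAt (fun y => (U y).1) d ξ)
    (h₂ : HasDerivAt (fun y => (U y).2) (ξ * d) ξ) :
    HasDerivAt (fun y => riemannInvariant γ ρs ε (U y)) 0 ξ := by
  refine ((h₂.div h₁ hρ.1.ne').add
    (((hasDerivAt_soundPotential hγ hρ).comp ξ h₁).const_mul √ε)).congr_deriv ?_
  rw [charSpeed_eq _ hγ hε hρ, Family.sgn] at hspeed
  have hρ₀ := hρ.1
  nth_rewrite 1 [← hspeed]
  field_simp
  ring

lemma IsRarefaction.exists_riemannInvariant_eq (hγ : 0 < γ) (hε : 0 ≤ ε)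
    (h : IsRarefaction γ ρs ε .first U a b L R) :
    ∃ C, ∀ ξ ∈ Ioo a b, riemannInvariant γ ρs ε (U ξ) = C := by
  obtain ⟨-, -, -, -, h⟩ := (isRarefaction_iff hγ hε).1 h
  have hderiv : ∀ ξ ∈ Ioo a b, HasDerivAt (fun y => riemannInvariant γ ρs ε (U y)) 0 ξ :=
    fun ξ hξ => by
      obtain ⟨hρ, hspeed, d, h₁, h₂⟩ := h ξ hξ
      exact hasDerivAt_riemannInvariant hγ hε hρ hspeed h₁ h₂
  exact isOpen_Ioo.exists_is_const_of_deriv_eq_zero isPreconnected_Ioo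
    (fun ξ hξ => (hderiv ξ hξ).differentiableAt.differentiableWithinAt)
    fun ξ hξ => (hderiv ξ hξ).deriv

lemma IsRarefaction.exists_sub_speedPotential_eq (hγ : 0 < γ) (hε : 0 ≤ ε)
    (h : IsRarefaction γ ρs ε .first U a b L R) :
    ∃ C, ∀ ξ ∈ Ioo a b, U ξ = invariantState γ ρs ε C (U ξ).1 ∧
      ξ = C - √ε * speedPotential γ ρs (U ξ).1 := by
  obtain ⟨C, hC⟩ := h.exists_riemannInvariant_eq hγ hε
  refine ⟨C, fun ξ hξ => ?_⟩
  obtain ⟨hρ, hspeed, -⟩ := h.2.2.2.2 ξ hξ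
  rw [← hC ξ hξ, ← charSpeed_first_eq_riemannInvariant_sub hγ hε hρ, hspeed]
  exact ⟨(invariantState_riemannInvariant γ ρs ε hρ.1.ne').symm, rfl⟩

lemma IsRarefaction.first_density_mem (hγ : 0 < γ) (hρs : 0 < ρs) (hε : 0 < ε)
    (h : IsRarefaction γ ρs ε .first U a b L R) (hξ : ξ ∈ Icc a b) : (U ξ).1 ∈ Ico 0 ρs := by
  obtain ⟨C, hC⟩ := h.exists_sub_speedPotential_eq hγ hε.le
  obtain ⟨hab, hc, -, -, hU⟩ := h
  rw [← closure_Ioo hab.ne] at hc hξ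
  obtain ⟨ρ₁, hρ₁, hlarge⟩ : ∃ ρ₁ ∈ Ioo 0 ρs, (C - a) / √ε < speedPotential γ ρs ρ₁ :=
    ((eventually_mem_set.2 (Ioo_mem_nhdsLT hρs)).and
      ((tendsto_speedPotential_atTop hγ hρs).eventually_gt_atTop _)).exists
  rw [div_lt_iff₀' (Real.sqrt_pos.2 hε)] at hlarge
  have hle : ∀ ξ ∈ Ioo a b, (U ξ).1 ≤ ρ₁ := fun ξ hξ => by
    refine ((strictMonoOn_speedPotential hγ).le_iff_le (hU ξ hξ).1 hρ₁).1
      (le_of_mul_le_mul_left ?_ (Real.sqrt_pos.2 hε))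
    linarith [(hC ξ hξ).2, hξ.1]
  exact ⟨le_on_closure (fun ξ hξ => (hU ξ hξ).1.1.le) continuousOn_const hc.fst hξ,
    (le_on_closure hle hc.fst continuousOn_const hξ).trans_lt hρ₁.2⟩

lemma strictMonoOn_Icc_of_Ioo {f : ℝ → ℝ} (hf : ContinuousOn f (Icc a b))
    (hmono : StrictMonoOn f (Ioo a b)) : StrictMonoOn f (Icc a b) := by
  intro x hx y hy hxy
  obtain ⟨c, hxc, hcy⟩ := exists_between hxy
  obtain ⟨d, hcd, hdy⟩ := exists_between hcy
  have hc : c ∈ Ioo a b := ⟨hx.1.trans_lt hxc, hcy.trans_le hy.2⟩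
  have hd : d ∈ Ioo a b := ⟨hc.1.trans hcd, hdy.trans_le hy.2⟩
  have hclL : closure (Ioo a c) = Icc a c := closure_Ioo hc.1.ne
  have hclR : closure (Ioo d b) = Icc d b := closure_Ioo hd.2.ne
  have hxc' : f x ≤ f c := by
    refine le_on_closure (s := Ioo a c) (g := fun _ => f c)
      (fun z hz => (hmono ⟨hz.1, hz.2.trans hc.2⟩ hc hz.2).le) ?_ continuousOn_const
      (hclL ▸ ⟨hx.1, hxc.le⟩)
    exact hclL ▸ hf.mono (Icc_subset_Icc_right hc.2.le)
  have hdy' : f d ≤ f y := by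
    refine le_on_closure (s := Ioo d b) (f := fun _ => f d)
      (fun z hz => (hmono hd ⟨hd.1.trans hz.1, hz.2⟩ hz.1).le) continuousOn_const ?_
      (hclR ▸ ⟨hdy.le, hy.2⟩)
    exact hclR ▸ hf.mono (Icc_subset_Icc_left hd.1.le)
  exact (hxc'.trans_lt (hmono hc hd hcd)).trans_le hdy'

lemma strictAntiOn_Icc_of_Ioo {f : ℝ → ℝ} (hf : ContinuousOn f (Icc a b))
    (hanti : StrictAntiOn f (Ioo a b)) : StrictAntiOn f (Icc a b) := by
  simpa only [Pi.neg_apply, neg_neg] using (strictMonoOn_Icc_of_Ioo hf.neg hanti.neg).neg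

lemma IsRarefaction.first_strictAntiOn_density (hγ : 0 < γ) (hε : 0 ≤ ε)
    (h : IsRarefaction γ ρs ε .first U a b L R) : StrictAntiOn (fun ξ => (U ξ).1) (Icc a b) := by
  obtain ⟨C, hC⟩ := h.exists_sub_speedPotential_eq hγ hε
  obtain ⟨-, hc, -, -, hU⟩ := h
  refine strictAntiOn_Icc_of_Ioo hc.fst fun x hx y hy hxy => ?_
  refine ((strictMonoOn_speedPotential hγ).lt_iff_lt (hU y hy).1 (hU x hx).1).1
    (lt_of_mul_lt_mul_left ?_ (Real.sqrt_nonneg ε))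
  linarith [(hC x hx).2, (hC y hy).2]

lemma IsRarefaction.first_right_density_lt (hγ : 0 < γ) (hε : 0 ≤ ε)
    (h : IsRarefaction γ ρs ε .first U a b L R) : R.1 < L.1 := by
  have hanti := h.first_strictAntiOn_density hγ hε
  obtain ⟨hab, -, rfl, rfl, -⟩ := h
  exact hanti (left_mem_Icc.2 hab.le) (right_mem_Icc.2 hab.le) hab

lemma IsRarefaction.first_right_density_mem (hγ : 0 < γ) (hρs : 0 < ρs) (hε : 0 < ε)
    (h : IsRarefaction γ ρs ε .first U a b L R) : R.1 ∈ Ico 0 ρs := by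
  have hmem := h.first_density_mem hγ hρs hε (right_mem_Icc.2 h.1.le)
  rwa [h.2.2.2.1] at hmem

lemma IsRarefaction.first_left_density_mem (hγ : 0 < γ) (hρs : 0 < ρs) (hε : 0 < ε)
    (h : IsRarefaction γ ρs ε .first U a b L R) : L.1 ∈ Ioo 0 ρs := by
  have hmem := h.first_density_mem hγ hρs hε (left_mem_Icc.2 h.1.le)
  rw [h.2.2.1] at hmem
  exact ⟨(h.first_right_density_mem hγ hρs hε).1.trans_lt (h.first_right_density_lt hγ hε.le),
    hmem.2⟩

lemma IsRarefaction.exists_sub_speedPotential_eq_Icc (hγ : 0 < γ) (hρs : 0 < ρs) (hε : 0 < ε)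
    (h : IsRarefaction γ ρs ε .first U a b L R) :
    ∃ C, ∀ ξ ∈ Icc a b, 0 < (U ξ).1 → U ξ = invariantState γ ρs ε C (U ξ).1 ∧
      ξ = C - √ε * speedPotential γ ρs (U ξ).1 := by
  obtain ⟨C, hC⟩ := h.exists_sub_speedPotential_eq hγ hε.le
  refine ⟨C, fun ξ hξ hpos => Prod.mk.inj ?_⟩
  have hne : (𝓝[Ioo a b] ξ).NeBot := by
    rwa [← mem_closure_iff_nhdsWithin_neBot, closure_Ioo h.1.ne]
  have hU : Tendsto U (𝓝[Ioo a b] ξ) (𝓝 (U ξ)) :=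
    (h.2.1 ξ hξ).mono_left (nhdsWithin_mono _ Ioo_subset_Icc_self)
  have hI : Ioo 0 ρs ∈ 𝓝 (U ξ).1 := Ioo_mem_nhds hpos (h.first_density_mem hγ hρs hε hξ).2
  have hcont : ContinuousAt
      (fun ρ => (invariantState γ ρs ε C ρ, C - √ε * speedPotential γ ρs ρ)) (U ξ).1 :=
    ((continuousOn_invariantState hγ).continuousAt hI).prodMk
      (continuousAt_const.sub (((continuousOn_speedPotential hγ).continuousAt hI).const_mul √ε))
  exact tendsto_nhds_unique_of_eventuallyEq
    (hU.prodMk_nhds (tendsto_id.mono_left nhdsWithin_le_nhds)) (hcont.tendsto.comp hU.fst_nhds)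
    (eventually_mem_nhdsWithin.mono fun ζ hζ => Prod.ext (hC ζ hζ).1 (hC ζ hζ).2)

lemma IsRarefaction.first_eq_invariantState (hγ : 0 < γ) (hρs : 0 < ρs) (hε : 0 < ε)
    (h : IsRarefaction γ ρs ε .first U a b L R) (hξ : ξ ∈ Icc a b) (hpos : 0 < (U ξ).1) :
    U ξ = invariantState γ ρs ε (riemannInvariant γ ρs ε L) (U ξ).1 ∧
      ξ = riemannInvariant γ ρs ε L - √ε * speedPotential γ ρs (U ξ).1 := by
  obtain ⟨C, hC⟩ := h.exists_sub_speedPotential_eq_Icc hγ hρs hε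
  have hL := (h.first_left_density_mem hγ hρs hε).1
  obtain ⟨hab, -, rfl, -, -⟩ := h
  have hLC : riemannInvariant γ ρs ε (U a) = C := by
    rw [(hC a (left_mem_Icc.2 hab.le) hL).1, riemannInvariant_invariantState _ _ _ _ hL.ne']
  rw [hLC]
  exact hC ξ hξ hpos

lemma IsRarefaction.first_charSpeed_eq (hγ : 0 < γ) (hρs : 0 < ρs) (hε : 0 < ε)
    (h : IsRarefaction γ ρs ε .first U a b L R) (hξ : ξ ∈ Icc a b) (hpos : 0 < (U ξ).1) :
    charSpeed γ ρs ε .first (U ξ) = ξ := by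
  obtain ⟨hstate, hspeed⟩ := h.first_eq_invariantState hγ hρs hε hξ hpos
  have hinv : riemannInvariant γ ρs ε (U ξ) = riemannInvariant γ ρs ε L := by
    rw [hstate, riemannInvariant_invariantState _ _ _ _ hpos.ne']
  rw [charSpeed_first_eq_riemannInvariant_sub hγ hε.le
    ⟨hpos, (h.first_density_mem hγ hρs hε hξ).2⟩, hinv, ← hspeed]

lemma IsRarefaction.first_charSpeed_left (hγ : 0 < γ) (hρs : 0 < ρs) (hε : 0 < ε)
    (h : IsRarefaction γ ρs ε .first U a b L R) : charSpeed γ ρs ε .first L = a := by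
  have hL := (h.first_left_density_mem hγ hρs hε).1
  have hspeed := h.first_charSpeed_eq hγ hρs hε (left_mem_Icc.2 h.1.le)
  rw [h.2.2.1] at hspeed
  exact hspeed hL

lemma IsRarefaction.first_charSpeed_right (hγ : 0 < γ) (hρs : 0 < ρs) (hε : 0 < ε)
    (h : IsRarefaction γ ρs ε .first U a b L R) (hR : 0 < R.1) :
    charSpeed γ ρs ε .first R = b := by
  have hspeed := h.first_charSpeed_eq hγ hρs hε (right_mem_Icc.2 h.1.le)
  rw [h.2.2.2.1] at hspeed
  exact hspeed hR

lemma IsRarefaction.first_velocity_eq (hγ : 0 < γ) (hρs : 0 < ρs) (hε : 0 < ε)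
    (h : IsRarefaction γ ρs ε .first U a b L R) (hR : 0 < R.1) :
    R.2 / R.1 = L.2 / L.1 - velocityJump γ ρs ε .rarefaction L.1 R.1 := by
  have hstate := h.first_eq_invariantState hγ hρs hε (right_mem_Icc.2 h.1.le)
  rw [h.2.2.2.1] at hstate
  nth_rewrite 1 [(hstate hR).1]
  simp only [invariantState, riemannInvariant, velocityJump, mul_div_cancel_left₀ _ hR.ne']
  ring

lemma IsRarefaction.first_le_speedPotential (hγ : 0 < γ) (hρs : 0 < ρs) (hε : 0 < ε)
    (h : IsRarefaction γ ρs ε .first U a b L R) (hR : R.1 = 0) (hρ : ρ ∈ Ioo 0 L.1) :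
    (riemannInvariant γ ρs ε L - b) / √ε ≤ speedPotential γ ρs ρ := by
  have hinv := fun ξ => h.first_eq_invariantState hγ hρs hε (ξ := ξ)
  obtain ⟨hab, hc, rfl, rfl, -⟩ := h
  obtain ⟨ξ, hξ, rfl⟩ := intermediate_value_Icc' hab.le hc.fst ⟨hR ▸ hρ.1.le, hρ.2.le⟩
  rw [div_le_iff₀' (Real.sqrt_pos.2 hε)]
  linarith [(hinv ξ hξ hρ.1).2, hξ.2]

lemma IsRarefaction.first_bddBelow_soundPotential (hγ : 0 < γ) (hρs : 0 < ρs) (hε : 0 < ε)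
    (h : IsRarefaction γ ρs ε .first U a b L R) (hR : R.1 = 0) :
    BddBelow (soundPotential γ ρs '' Ioo 0 ρs) :=
  bddBelow_soundPotential_of_le_speedPotential hγ (h.first_left_density_mem hγ hρs hε).1
    fun _ => h.first_le_speedPotential hγ hρs hε hR

lemma IsRarefaction.first_vacuum_speed_le (hγ : 0 < γ) (hρs : 0 < ρs) (hε : 0 < ε)
    (h : IsRarefaction γ ρs ε .first U a b L R) (hR : R.1 = 0) :
    riemannInvariant γ ρs ε L - √ε * vacuumPotential γ ρs ≤ b := by
  have hle := le_vacuumPotential_of_le_speedPotential hγ hρs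
    (h.first_left_density_mem hγ hρs hε).1 fun _ => h.first_le_speedPotential hγ hρs hε hR
  rw [div_le_iff₀' (Real.sqrt_pos.2 hε)] at hle
  linarith

lemma tendsto_invariantState_zero (hγ : 0 < γ) (hρs : 0 < ρs)
    (hbdd : BddBelow (soundPotential γ ρs '' Ioo 0 ρs)) :
    Tendsto (invariantState γ ρs ε C) (𝓝[>] 0) (𝓝 (0, 0)) := by
  have hid : Tendsto (fun ρ : ℝ => ρ) (𝓝[>] 0) (𝓝 0) := tendsto_id.mono_left nhdsWithin_le_nhds
  refine hid.prodMk_nhds ?_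
  simpa only [zero_mul] using hid.mul
    (((tendsto_soundPotential_zero hbdd hγ hρs).const_mul √ε).const_sub C)

lemma IsRarefaction.first_vacuum_eq (hγ : 0 < γ) (hρs : 0 < ρs) (hε : 0 < ε)
    (h : IsRarefaction γ ρs ε .first U a b L R) (hR : R.1 = 0) : R = (0, 0) := by
  have hbdd := h.first_bddBelow_soundPotential hγ hρs hε hR
  have hinv := fun ξ => h.first_eq_invariantState hγ hρs hε (ξ := ξ)
  obtain ⟨hab, hc, -, rfl, hU⟩ := h
  have hne : (𝓝[Ioo a b] b).NeBot := by
    rw [← mem_closure_iff_nhdsWithin_neBot, closure_Ioo hab.ne]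
    exact right_mem_Icc.2 hab.le
  have hlim : Tendsto U (𝓝[Ioo a b] b) (𝓝 (U b)) :=
    (hc b (right_mem_Icc.2 hab.le)).mono_left (nhdsWithin_mono _ Ioo_subset_Icc_self)
  have hρ : Tendsto (fun ξ => (U ξ).1) (𝓝[Ioo a b] b) (𝓝[>] 0) :=
    tendsto_nhdsWithin_iff.2 ⟨hR ▸ hlim.fst_nhds,
      eventually_mem_nhdsWithin.mono fun ξ hξ => (hU ξ hξ).1.1⟩
  exact tendsto_nhds_unique_of_eventuallyEq hlim
    ((tendsto_invariantState_zero hγ hρs hbdd).comp hρ)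
    (eventually_mem_nhdsWithin.mono fun ξ hξ =>
      (hinv ξ (Ioo_subset_Icc_self hξ) (hU ξ hξ).1.1).1)

lemma continuousOn_invFunOn_image {α β : Type*} [TopologicalSpace α] [TopologicalSpace β]
    [T2Space β] [Nonempty α] {f : α → β} {K : Set α} (hK : IsCompact K) (hf : ContinuousOn f K)
    (hinj : InjOn f K) : ContinuousOn (Function.invFunOn f K) (f '' K) := by
  refine continuousOn_iff_isClosed.2 fun t ht =>
    ⟨f '' (K ∩ t), ((hK.inter_right ht).image_of_continuousOn (hf.mono inter_subset_left)).isClosed,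
      ?_⟩
  ext y
  constructor
  · rintro ⟨hy, x, hx, rfl⟩
    rw [mem_preimage, hinj.leftInvOn_invFunOn hx] at hy
    exact ⟨mem_image_of_mem f ⟨hx, hy⟩, mem_image_of_mem f hx⟩
  · rintro ⟨⟨x, ⟨hx, hxt⟩, rfl⟩, hy⟩
    refine ⟨?_, hy⟩
    rwa [mem_preimage, hinj.leftInvOn_invFunOn hx]

lemma exists_continuousOn_inverse_of_strictAntiOn {f : ℝ → ℝ} (hab : a ≤ b)
    (hf : ContinuousOn f (Icc a b)) (hanti : StrictAntiOn f (Icc a b)) :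
    ∃ g : ℝ → ℝ, ContinuousOn g (Icc (f b) (f a)) ∧ MapsTo g (Icc (f b) (f a)) (Icc a b) ∧
      LeftInvOn g f (Icc a b) ∧ ∀ y ∈ Ioo (f b) (f a), g y ∈ Ioo a b ∧ f (g y) = y := by
  have himage : f '' Icc a b = Icc (f b) (f a) :=
    hf.image_Icc_of_antitoneOn hab hanti.antitoneOn
  have hleft : LeftInvOn (Function.invFunOn f (Icc a b)) f (Icc a b) :=
    hanti.injOn.leftInvOn_invFunOn
  refine ⟨Function.invFunOn f (Icc a b),
    himage ▸ continuousOn_invFunOn_image isCompact_Icc hf hanti.injOn, ?_, hleft, fun y hy => ?_⟩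
  · rw [← himage]
    rintro _ ⟨x, hx, rfl⟩
    rwa [hleft hx]
  · obtain ⟨x, hx, rfl⟩ := himage.symm ▸ Ioo_subset_Icc_self hy
    rw [hleft hx]
    exact ⟨⟨(hanti.lt_iff_gt hx (left_mem_Icc.2 hab)).1 hy.2,
      (hanti.lt_iff_gt (right_mem_Icc.2 hab) hx).1 hy.1⟩, rfl⟩

/-- The profile is the inverse of the speed `S`, which may be prescribed at the end `α` because the
speed potential has no value at the vacuum. -/
lemma exists_isRarefaction_first_of_speed {α β : ℝ} {S : ℝ → ℝ} (hγ : 0 < γ) (hε : 0 < ε)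
    (hα : 0 ≤ α) (hαβ : α < β) (hβ : β < ρs) (hS : ContinuousOn S (Icc α β))
    (hSG : EqOn S (fun ρ => C - √ε * speedPotential γ ρs ρ) (Ioo α β))
    (hstate : ContinuousOn (invariantState γ ρs ε C) (Icc α β)) :
    ∃ U, IsRarefaction γ ρs ε .first U (S β) (S α) (invariantState γ ρs ε C β)
      (invariantState γ ρs ε C α) := by
  have hsub : Ioo α β ⊆ Ioo 0 ρs := Ioo_subset_Ioo hα hβ.le
  have hanti : StrictAntiOn S (Icc α β) := strictAntiOn_Icc_of_Ioo hS fun x hx y hy hxy => by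
    rw [hSG hx, hSG hy]
    exact sub_lt_sub_left (mul_lt_mul_of_pos_left
      (strictMonoOn_speedPotential hγ (hsub hx) (hsub hy) hxy) (Real.sqrt_pos.2 hε)) C
  obtain ⟨g, hg, hgmem, hgS, hgI⟩ := exists_continuousOn_inverse_of_strictAntiOn hαβ.le hS hanti
  have hα' := left_mem_Icc.2 hαβ.le
  have hβ' := right_mem_Icc.2 hαβ.le
  refine ⟨fun ξ => invariantState γ ρs ε C (g ξ), (isRarefaction_iff hγ hε.le).2
    ⟨hanti hα' hβ' hαβ, hstate.comp hg hgmem, by rw [hgS hβ'], by rw [hgS hα'], fun ξ hξ => ?_⟩⟩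
  have hspeed : ∀ y ∈ Ioo (S β) (S α), C - √ε * speedPotential γ ρs (g y) = y := fun y hy =>
    (hSG (hgI y hy).1).symm.trans (hgI y hy).2
  have hρ := hsub (hgI ξ hξ).1
  have hg' := HasDerivAt.of_local_left_inverse (hg.continuousAt (Icc_mem_nhds hξ.1 hξ.2))
    (((hasDerivAt_speedPotential hγ hρ).const_mul √ε).const_sub C)
    (neg_ne_zero.2 (mul_pos (Real.sqrt_pos.2 hε) (speedPotential_deriv_pos hγ hρ)).ne')
    ((eventually_mem_set.2 (Ioo_mem_nhds hξ.1 hξ.2)).mono hspeed)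
  refine ⟨hρ, ?_, _, hg', ?_⟩
  · rw [charSpeed_first_eq_riemannInvariant_sub hγ hε.le hρ,
      riemannInvariant_invariantState _ _ _ _ hρ.1.ne']
    exact hspeed ξ hξ
  · exact ((hasDerivAt_invariantState_snd hγ hρ).comp ξ hg').congr_deriv (by rw [hspeed ξ hξ])

lemma exists_isRarefaction_first (hγ : 0 < γ) (hε : 0 < ε) (hR : 0 < R.1) (hlt : R.1 < L.1)
    (hL : L.1 < ρs) (h : R.2 / R.1 = L.2 / L.1 - velocityJump γ ρs ε .rarefaction L.1 R.1) :
    ∃ U a b, IsRarefaction γ ρs ε .first U a b L R := by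
  have hsub : Icc R.1 L.1 ⊆ Ioo 0 ρs := fun x hx => ⟨hR.trans_le hx.1, hx.2.trans_lt hL⟩
  obtain ⟨U, hU⟩ := exists_isRarefaction_first_of_speed
    (C := riemannInvariant γ ρs ε L) hγ hε hR.le hlt hL
    (continuousOn_const.sub (((continuousOn_speedPotential hγ).mono hsub).const_mul √ε))
    (fun _ _ => rfl) ((continuousOn_invariantState hγ).mono hsub)
  have hinv : riemannInvariant γ ρs ε R = riemannInvariant γ ρs ε L := by
    simp only [riemannInvariant, h, velocityJump]
    ring
  rw [invariantState_riemannInvariant _ _ _ (hR.trans hlt).ne'] at hU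
  nth_rewrite 3 [← hinv] at hU
  rw [invariantState_riemannInvariant _ _ _ hR.ne'] at hU
  exact ⟨U, _, _, hU⟩

lemma exists_isRarefaction_first_vacuum (hγ : 0 < γ) (hε : 0 < ε) (hL : L.1 ∈ Ioo 0 ρs)
    (hbdd : BddBelow (soundPotential γ ρs '' Ioo 0 ρs)) :
    ∃ U a, IsRarefaction γ ρs ε .first U a
      (riemannInvariant γ ρs ε L - √ε * vacuumPotential γ ρs) L (0, 0) := by
  have hρs := hL.1.trans hL.2
  have hsub : Icc 0 L.1 ⊆ Ico 0 ρs := Icc_subset_Ico_right hL.2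
  have hstate : ∀ C, ContinuousOn (invariantState γ ρs ε C) (Ico 0 ρs) := fun C => by
    have hzero : invariantState γ ρs ε C 0 = (0, 0) := by simp [invariantState]
    rw [← Function.update_eq_self 0 (invariantState γ ρs ε C), continuousOn_update_iff,
      Ico_sdiff_left, hzero]
    exact ⟨continuousOn_invariantState hγ, fun _ =>
      (tendsto_invariantState_zero hγ hρs hbdd).mono_left (nhdsWithin_mono _ Ioo_subset_Ioi_self)⟩
  obtain ⟨U, hU⟩ := exists_isRarefaction_first_of_speed (C := riemannInvariant γ ρs ε L)
    (S := fun ρ => riemannInvariant γ ρs ε L -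
      √ε * Function.update (speedPotential γ ρs) 0 (vacuumPotential γ ρs) ρ)
    hγ hε le_rfl hL.1 hL.2
    (continuousOn_const.sub
      (((continuousOn_update_speedPotential hbdd hγ hρs).mono hsub).const_mul √ε))
    (fun ρ hρ => by simp only [Function.update_of_ne hρ.1.ne']) ((hstate _).mono hsub)
  rw [invariantState_riemannInvariant _ _ _ hL.1.ne'] at hU
  simp only [Function.update_self, invariantState, zero_mul] at hU
  exact ⟨U, _, hU⟩

end Rarefaction

/-! ### Waves and fans -/

variable {c : ℝ} {w w₁ w₂ : WaveKind} {U V : ℝ → ℝ × ℝ} {l m r : ℝ × ℝ}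

lemma IsWave.reflect (hγ : 0 < γ) (hε : 0 ≤ ε) (h : IsWave γ ρs ε k w U a b L R) :
    IsWave γ ρs ε k.opposite w (fun ξ => reflect (U (-ξ))) (-b) (-a) (reflect R) (reflect L) := by
  cases w
  · obtain ⟨rfl, h⟩ := h
    exact ⟨rfl, h.reflect⟩
  · exact IsRarefaction.reflect hγ hε h

lemma IsWave.congr (hγ : 0 < γ) (hε : 0 ≤ ε) (h : IsWave γ ρs ε k w U a b L R)
    (hUV : EqOn V U (Icc a b)) : IsWave γ ρs ε k w V a b L R := by
  cases w
  · exact h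
  · exact IsRarefaction.congr hγ hε h hUV

lemma IsWave.le (h : IsWave γ ρs ε k w U a b L R) : a ≤ b := by
  cases w
  · exact h.1.le
  · obtain ⟨h, -⟩ := h
    exact h.le

lemma charSpeed_first_lt_velocity (hγ : 0 < γ) (hε : 0 < ε) (hv : v.1 ∈ Ioo 0 ρs) :
    charSpeed γ ρs ε .first v < v.2 / v.1 := by
  rw [charSpeed_eq _ hγ hε.le hv, Family.sgn, neg_one_mul, ← sub_eq_add_neg]
  exact sub_lt_self _ (mul_pos (Real.sqrt_pos.2 hε) (div_pos (impedance_pos hγ hv) hv.1))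

lemma IsWave.isAdmissibleJump_first (hγ : 0 < γ) (hε : 0 ≤ ε)
    (h : IsWave γ ρs ε .first w U a b L R) : IsAdmissibleJump w L.1 R.1 := by
  cases w
  · exact h.2.first_density_lt hγ hε
  · exact IsRarefaction.first_right_density_lt hγ hε h

section FirstWave

variable (hγ : 0 < γ) (hρs : 0 < ρs) (hε : 0 < ε) (h : IsWave γ ρs ε .first w U a b L R)

include hγ hρs hε h

lemma IsWave.first_left_density_mem : L.1 ∈ Ioo 0 ρs := by
  cases w
  · exact h.2.1
  · exact IsRarefaction.first_left_density_mem hγ hρs hε h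

lemma IsWave.first_right_density_mem : R.1 ∈ Ico 0 ρs := by
  cases w
  · exact ⟨h.2.2.1.1.le, h.2.2.1.2⟩
  · exact IsRarefaction.first_right_density_mem hγ hρs hε h

lemma IsWave.first_le_charSpeed_left : a ≤ charSpeed γ ρs ε .first L := by
  cases w
  · obtain ⟨-, -, -, -, -, -, hlax⟩ := h
    exact hlax.le
  · exact (IsRarefaction.first_charSpeed_left hγ hρs hε h).ge

lemma IsWave.first_lt_velocity_left : a < L.2 / L.1 :=
  (h.first_le_charSpeed_left hγ hρs hε).trans_lt
    (charSpeed_first_lt_velocity hγ hε (h.first_left_density_mem hγ hρs hε))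

lemma IsWave.first_charSpeed_right_le (hR : 0 < R.1) : charSpeed γ ρs ε .first R ≤ b := by
  cases w
  · obtain ⟨rfl, -, -, -, -, hlax, -⟩ := h
    exact hlax.le
  · exact (IsRarefaction.first_charSpeed_right hγ hρs hε h hR).le

lemma IsWave.first_lt_velocity_right (hR : 0 < R.1) : b < R.2 / R.1 := by
  cases w
  · obtain ⟨rfl, h⟩ := h
    exact h.first_lt_velocity hγ hε.le
  · rw [← IsRarefaction.first_charSpeed_right hγ hρs hε h hR]
    exact charSpeed_first_lt_velocity hγ hε
      ⟨hR, (IsRarefaction.first_right_density_mem hγ hρs hε h).2⟩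

lemma IsWave.first_velocity_eq (hR : 0 < R.1) :
    R.2 / R.1 = L.2 / L.1 - velocityJump γ ρs ε w L.1 R.1 := by
  cases w
  · exact h.2.first_velocity_eq hγ hε.le
  · exact IsRarefaction.first_velocity_eq hγ hρs hε h hR

lemma IsWave.first_vacuum (hR : R.1 = 0) :
    w = .rarefaction ∧ R = (0, 0) ∧ BddBelow (soundPotential γ ρs '' Ioo 0 ρs) ∧
      riemannInvariant γ ρs ε L - √ε * vacuumPotential γ ρs ≤ b := by
  cases w
  · exact absurd hR h.2.2.1.1.ne'
  · exact ⟨rfl, IsRarefaction.first_vacuum_eq hγ hρs hε h hR,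
      IsRarefaction.first_bddBelow_soundPotential hγ hρs hε h hR,
      IsRarefaction.first_vacuum_speed_le hγ hρs hε h hR⟩

end FirstWave

lemma IsWave.isAdmissibleJump_second (hγ : 0 < γ) (hε : 0 ≤ ε)
    (h : IsWave γ ρs ε .second w U a b L R) : IsAdmissibleJump w R.1 L.1 := by
  simpa only [reflect_fst] using (h.reflect hγ hε).isAdmissibleJump_first hγ hε

lemma charSpeed_first_reflect (γ ρs ε : ℝ) (v : ℝ × ℝ) :
    charSpeed γ ρs ε .first (reflect v) = -charSpeed γ ρs ε .second v :=
  charSpeed_reflect γ ρs ε .second v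

section SecondWave

variable (hγ : 0 < γ) (hρs : 0 < ρs) (hε : 0 < ε) (h : IsWave γ ρs ε .second w U a b L R)

include hγ hρs hε h

lemma IsWave.second_right_density_mem : R.1 ∈ Ioo 0 ρs := by
  simpa only [reflect_fst] using (h.reflect hγ hε.le).first_left_density_mem hγ hρs hε

lemma IsWave.second_charSpeed_right_le : charSpeed γ ρs ε .second R ≤ b := by
  have hle := (h.reflect hγ hε.le).first_le_charSpeed_left hγ hρs hε
  rwa [charSpeed_first_reflect, neg_le_neg_iff] at hle

lemma IsWave.second_velocity_right_lt : R.2 / R.1 < b := by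
  have hlt := (h.reflect hγ hε.le).first_lt_velocity_left hγ hρs hε
  rwa [reflect_fst, reflect_snd, neg_div, neg_lt_neg_iff] at hlt

lemma IsWave.second_le_charSpeed_left (hL : 0 < L.1) : a ≤ charSpeed γ ρs ε .second L := by
  have hle := (h.reflect hγ hε.le).first_charSpeed_right_le hγ hρs hε hL
  rwa [charSpeed_first_reflect, neg_le_neg_iff] at hle

lemma IsWave.second_velocity_left_lt (hL : 0 < L.1) : L.2 / L.1 < a := by
  have hlt := (h.reflect hγ hε.le).first_lt_velocity_right hγ hρs hε hL
  rwa [reflect_fst, reflect_snd, neg_div, neg_lt_neg_iff] at hlt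

lemma IsWave.second_velocity_eq (hL : 0 < L.1) :
    L.2 / L.1 = R.2 / R.1 + velocityJump γ ρs ε w R.1 L.1 := by
  have heq := (h.reflect hγ hε.le).first_velocity_eq hγ hρs hε hL
  simp only [reflect_fst, reflect_snd, neg_div] at heq
  linarith

lemma IsWave.second_vacuum (hL : L.1 = 0) :
    w = .rarefaction ∧
      a ≤ √ε * vacuumPotential γ ρs - riemannInvariant γ ρs ε (_root_.reflect R) := by
  obtain ⟨hw, -, -, hle⟩ := (h.reflect hγ hε.le).first_vacuum hγ hρs hε hL
  exact ⟨hw, by linarith⟩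

end SecondWave

/-- The two bounds hold at the end of a wave of the second family; a further wave of the first
family would be slower than the fluid, one of the second family not faster than its left state. -/
lemma IsFan.eq_const (hγ : 0 < γ) (hρs : 0 < ρs) (hε : 0 < ε) (h : IsFan γ ρs ε U r c v)
    (hv : 0 < v.1) (hvel : v.2 / v.1 < c) (hspeed : charSpeed γ ρs ε .second v ≤ c) :
    v = r ∧ ∀ ξ, c < ξ → U ξ = r := by
  cases h with
  | const _ h => exact ⟨rfl, h⟩
  | wave _ a b _ v' k w hca _ hw _ =>
    cases k
    · exact absurd (hw.first_lt_velocity_left hγ hρs hε) (hvel.trans hca).not_gt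
    · exact absurd (hw.second_le_charSpeed_left hγ hρs hε hv) (hspeed.trans_lt hca).not_ge

/-- The bound holds at the end of a wave of the first family. -/
lemma IsFan.const_or_second (hγ : 0 < γ) (hρs : 0 < ρs) (hε : 0 < ε) (h : IsFan γ ρs ε U r c v)
    (hspeed : 0 < v.1 → charSpeed γ ρs ε .first v ≤ c) :
    v = r ∨ ∃ a b w, c < a ∧ (∀ ξ ∈ Ioo c a, U ξ = v) ∧
      IsWave γ ρs ε .second w U a b v r ∧ ∀ ξ, b < ξ → U ξ = r := by
  cases h with
  | const _ h => exact .inl rfl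
  | wave _ a b _ v' k w hca hv hw hf =>
    cases k
    · exact absurd (hw.first_le_charSpeed_left hγ hρs hε)
        ((hspeed (hw.first_left_density_mem hγ hρs hε).1).trans_lt hca).not_ge
    · obtain ⟨rfl, hr⟩ := hf.eq_const hγ hρs hε (hw.second_right_density_mem hγ hρs hε).1
        (hw.second_velocity_right_lt hγ hρs hε) (hw.second_charSpeed_right_le hγ hρs hε)
      exact .inr ⟨a, b, w, hca, hv, hw, hr⟩

lemma IsRiemannSolution.eq_or_isWave_or_hasForm (hγ : 0 < γ) (hρs : 0 < ρs) (hε : 0 < ε)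
    (h : IsRiemannSolution γ ρs ε l r U) :
    l = r ∨ (∃ k a b w, IsWave γ ρs ε k w U a b l r) ∨ ∃ w₁ w₂ m, HasForm γ ρs ε l r w₁ w₂ m U := by
  obtain ⟨c, hc, h⟩ := h
  cases h with
  | const _ h => exact .inl rfl
  | wave _ a b _ v' k w hca h hw hf =>
    right
    cases k
    · rcases hf.const_or_second hγ hρs hε (hw.first_charSpeed_right_le hγ hρs hε) with
        rfl | ⟨a₂, b₂, w₂, hba, hm, hw₂, hr⟩
      · exact .inl ⟨_, a, b, w, hw⟩
      · refine .inr ⟨w, w₂, v', a, b, a₂, b₂, hw.le, hba, hw₂.le, fun ξ hξ => ?_, hw, hm, hw₂, hr⟩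
        rcases le_or_gt ξ c with hξc | hξc
        exacts [hc ξ hξc, h ξ ⟨hξc, hξ⟩]
    · obtain ⟨rfl, -⟩ := hf.eq_const hγ hρs hε (hw.second_right_density_mem hγ hρs hε).1
        (hw.second_velocity_right_lt hγ hρs hε) (hw.second_charSpeed_right_le hγ hρs hε)
      exact .inl ⟨_, a, b, w, hw⟩

lemma IsWave.totalJump_eq (hγ : 0 < γ) (hε : 0 < ε) (hL : L.1 ∈ Ioo 0 ρs) (hR : R.1 ∈ Ioo 0 ρs)
    (h : IsWave γ ρs ε k w U a b L R) :
    totalJump γ ρs ε L.1 R.1 L.1 = L.2 / L.1 - R.2 / R.1 ∨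
      totalJump γ ρs ε L.1 R.1 R.1 = L.2 / L.1 - R.2 / R.1 := by
  have hρs := hL.1.trans hL.2
  rw [totalJump_left, totalJump_right]
  cases k
  · right
    rw [(h.isAdmissibleJump_first hγ hε.le).compositeJump_eq]
    linarith [h.first_velocity_eq hγ hρs hε hR.1]
  · left
    rw [(h.isAdmissibleJump_second hγ hε.le).compositeJump_eq]
    linarith [h.second_velocity_eq hγ hρs hε hL.1]

lemma IsRiemannSolution.totalJump_eq_or_hasForm (hγ : 0 < γ) (hε : 0 < ε) (hl : l.1 ∈ Ioo 0 ρs)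
    (hr : r.1 ∈ Ioo 0 ρs) (h : IsRiemannSolution γ ρs ε l r U) :
    (totalJump γ ρs ε l.1 r.1 l.1 = l.2 / l.1 - r.2 / r.1 ∨
      totalJump γ ρs ε l.1 r.1 r.1 = l.2 / l.1 - r.2 / r.1) ∨
      ∃ w₁ w₂ m, HasForm γ ρs ε l r w₁ w₂ m U := by
  rcases h.eq_or_isWave_or_hasForm hγ (hl.1.trans hl.2) hε with rfl | ⟨k, a, b, w, hw⟩ | hform
  · exact .inl (.inl (by rw [totalJump_left, compositeJump_self, sub_self]))
  · exact .inl (hw.totalJump_eq hγ hε hl hr)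
  · exact .inr hform

lemma HasForm.density_mem (hγ : 0 < γ) (hρs : 0 < ρs) (hε : 0 < ε)
    (h : HasForm γ ρs ε l r w₁ w₂ m U) : m.1 ∈ Ico 0 ρs := by
  obtain ⟨a₁, b₁, a₂, b₂, -, -, -, -, h₁, -⟩ := h
  exact h₁.first_right_density_mem hγ hρs hε

lemma HasForm.isAdmissibleJump (hγ : 0 < γ) (hε : 0 ≤ ε) (h : HasForm γ ρs ε l r w₁ w₂ m U) :
    IsAdmissibleJump w₁ l.1 m.1 ∧ IsAdmissibleJump w₂ r.1 m.1 := by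
  obtain ⟨a₁, b₁, a₂, b₂, -, -, -, -, h₁, -, h₂, -⟩ := h
  exact ⟨h₁.isAdmissibleJump_first hγ hε, h₂.isAdmissibleJump_second hγ hε⟩

lemma HasForm.velocity_eq (hγ : 0 < γ) (hρs : 0 < ρs) (hε : 0 < ε)
    (h : HasForm γ ρs ε l r w₁ w₂ m U) (hm : 0 < m.1) :
    m.2 / m.1 = l.2 / l.1 - velocityJump γ ρs ε w₁ l.1 m.1 ∧
      m.2 / m.1 = r.2 / r.1 + velocityJump γ ρs ε w₂ r.1 m.1 := by
  obtain ⟨a₁, b₁, a₂, b₂, -, -, -, -, h₁, -, h₂, -⟩ := h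
  exact ⟨h₁.first_velocity_eq hγ hρs hε hm, h₂.second_velocity_eq hγ hρs hε hm⟩

lemma HasForm.totalJump_eq (hγ : 0 < γ) (hρs : 0 < ρs) (hε : 0 < ε)
    (h : HasForm γ ρs ε l r w₁ w₂ m U) (hm : 0 < m.1) :
    totalJump γ ρs ε l.1 r.1 m.1 = l.2 / l.1 - r.2 / r.1 := by
  obtain ⟨hadm₁, hadm₂⟩ := h.isAdmissibleJump hγ hε.le
  obtain ⟨hvel₁, hvel₂⟩ := h.velocity_eq hγ hρs hε hm
  rw [totalJump, hadm₁.compositeJump_eq, hadm₂.compositeJump_eq]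
  linarith

lemma HasForm.vacuum (hγ : 0 < γ) (hρs : 0 < ρs) (hε : 0 < ε)
    (h : HasForm γ ρs ε l r w₁ w₂ m U) (hm : m.1 = 0) :
    w₁ = .rarefaction ∧ w₂ = .rarefaction ∧ m = (0, 0) ∧
      BddBelow (soundPotential γ ρs '' Ioo 0 ρs) ∧ l.2 / l.1 - r.2 / r.1 <
        √ε * (2 * vacuumPotential γ ρs - soundPotential γ ρs l.1 - soundPotential γ ρs r.1) := by
  obtain ⟨a₁, b₁, a₂, b₂, -, hba, -, -, h₁, -, h₂, -⟩ := h
  obtain ⟨hw₁, hm₀, hbdd, hle₁⟩ := h₁.first_vacuum hγ hρs hε hm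
  obtain ⟨hw₂, hle₂⟩ := h₂.second_vacuum hγ hρs hε hm
  refine ⟨hw₁, hw₂, hm₀, hbdd, ?_⟩
  simp only [riemannInvariant, reflect_fst, reflect_snd, neg_div] at hle₁ hle₂
  linarith

lemma exists_isWave_first (hγ : 0 < γ) (hε : 0 < ε) (hL : L.1 ∈ Ioo 0 ρs) (hR : R.1 ∈ Ioo 0 ρs)
    (hw : IsAdmissibleJump w L.1 R.1)
    (h : R.2 / R.1 = L.2 / L.1 - velocityJump γ ρs ε w L.1 R.1) :
    ∃ U a b, IsWave γ ρs ε .first w U a b L R := by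
  cases w
  · obtain ⟨σ, hσ⟩ := exists_isShock_first hγ hε hL.1 hw hR.2 h
    exact ⟨fun _ => L, σ, σ, rfl, hσ⟩
  · exact exists_isRarefaction_first hγ hε hR.1 hw hL.2 h

lemma exists_isWave_second (hγ : 0 < γ) (hε : 0 < ε) (hL : L.1 ∈ Ioo 0 ρs) (hR : R.1 ∈ Ioo 0 ρs)
    (hw : IsAdmissibleJump w R.1 L.1)
    (h : L.2 / L.1 = R.2 / R.1 + velocityJump γ ρs ε w R.1 L.1) :
    ∃ U a b, IsWave γ ρs ε .second w U a b L R := by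
  obtain ⟨U, a, b, hU⟩ := exists_isWave_first (L := reflect R) (R := reflect L) hγ hε hR hL hw
    (by simp only [reflect_fst, reflect_snd, neg_div]; linarith)
  have hU' := hU.reflect hγ hε.le
  rw [reflect_reflect, reflect_reflect] at hU'
  exact ⟨_, _, _, hU'⟩

lemma exists_isRiemannSolution_of_isWave {a₁ b₁ a₂ b₂ : ℝ} {U₁ U₂ : ℝ → ℝ × ℝ} (hγ : 0 < γ)
    (hε : 0 ≤ ε) (h₁ : IsWave γ ρs ε .first w₁ U₁ a₁ b₁ l m)
    (h₂ : IsWave γ ρs ε .second w₂ U₂ a₂ b₂ m r) (h : b₁ < a₂) :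
    ∃ U, IsRiemannSolution γ ρs ε l r U := by
  have hle₁ := h₁.le
  have hle₂ := h₂.le
  refine ⟨fun ξ => if ξ < a₁ then l else if ξ ≤ b₁ then U₁ ξ else if ξ < a₂ then m else
    if ξ ≤ b₂ then U₂ ξ else r, a₁ - 1, fun ξ hξ => if_pos (by linarith), ?_⟩
  refine .wave _ a₁ b₁ l m .first w₁ (by linarith) (fun ξ hξ => if_pos hξ.2)
    (h₁.congr hγ hε fun ξ hξ => ?_)
    (.wave _ a₂ b₂ m r .second w₂ h (fun ξ hξ => ?_) (h₂.congr hγ hε fun ξ hξ => ?_)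
      (.const _ fun ξ hξ => ?_))
  · simp only [if_neg hξ.1.not_gt, if_pos hξ.2]
  · simp only [if_neg (hle₁.trans_lt hξ.1).not_gt, if_neg hξ.1.not_ge, if_pos hξ.2]
  · have hbξ := h.trans_le hξ.1
    simp only [if_neg (hle₁.trans_lt hbξ).not_gt, if_neg hbξ.not_ge, if_neg hξ.1.not_gt,
      if_pos hξ.2]
  · have haξ := hle₂.trans_lt hξ
    have hbξ := h.trans haξ
    simp only [if_neg (hle₁.trans_lt hbξ).not_gt, if_neg hbξ.not_ge, if_neg haξ.not_gt,
      if_neg hξ.not_ge]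

/-! ### Solution of the Riemann problem -/

lemma waveCurve_first_div (w : WaveKind) (hv : 0 < v.1) (hρ : 0 < ρ) :
    waveCurve γ ρs ε .first w v ρ / ρ = v.2 / v.1 - velocityJump γ ρs ε w v.1 ρ := by
  rw [waveCurve_eq _ _ hv hρ, mul_div_cancel_left₀ _ hρ.ne', Family.sgn]
  ring

lemma waveCurve_second_div (w : WaveKind) (hv : 0 < v.1) (hρ : 0 < ρ) :
    waveCurve γ ρs ε .second w v ρ / ρ = v.2 / v.1 + velocityJump γ ρs ε w v.1 ρ := by
  rw [waveCurve_eq _ _ hv hρ, mul_div_cancel_left₀ _ hρ.ne', Family.sgn, one_mul]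

lemma waveCurve_first_eq_second_iff (hl : 0 < l.1) (hr : 0 < r.1) (hρ : 0 < ρ) :
    waveCurve γ ρs ε .first w₁ l ρ = waveCurve γ ρs ε .second w₂ r ρ ↔
      velocityJump γ ρs ε w₁ l.1 ρ + velocityJump γ ρs ε w₂ r.1 ρ = l.2 / l.1 - r.2 / r.1 := by
  rw [← div_left_inj' hρ.ne', waveCurve_first_div _ hl hρ, waveCurve_second_div _ hr hρ,
    sub_eq_iff_eq_add, add_assoc, sub_eq_iff_eq_add'.symm, add_comm, eq_comm]

section Solving

variable (hγ : 0 < γ) (hε : 0 < ε) (hl : l.1 ∈ Ioo 0 ρs) (hr : r.1 ∈ Ioo 0 ρs)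

include hγ hε hl hr

lemma IsRiemannSolution.hasForm_of_totalJump_eq (hU : IsRiemannSolution γ ρs ε l r U)
    (hρ : ρ ∈ Ioo 0 ρs) (h₁ : IsAdmissibleJump w₁ l.1 ρ) (h₂ : IsAdmissibleJump w₂ r.1 ρ)
    (h : totalJump γ ρs ε l.1 r.1 ρ = l.2 / l.1 - r.2 / r.1) :
    HasForm γ ρs ε l r w₁ w₂ (ρ, waveCurve γ ρs ε .first w₁ l ρ) U := by
  have hρs := hl.1.trans hl.2
  have hunique : ∀ x ∈ Ioo 0 ρs, totalJump γ ρs ε l.1 r.1 x = l.2 / l.1 - r.2 / r.1 → ρ = x :=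
    fun x hx hxD => (strictMonoOn_totalJump hγ hε hl hr).injOn hρ hx (h.trans hxD.symm)
  rcases hU.totalJump_eq_or_hasForm hγ hε hl hr with (hD | hD) | ⟨w₁', w₂', ⟨x, q⟩, hform⟩
  · exact absurd (hunique _ hl hD) h₁.ne
  · exact absurd (hunique _ hr hD) h₂.ne
  obtain ⟨h₁', h₂'⟩ := hform.isAdmissibleJump hγ hε.le
  have hx := hform.density_mem hγ hρs hε
  rcases hx.1.eq_or_lt with hx₀ | hx₀
  · obtain ⟨-, -, -, hbdd, hlt⟩ := hform.vacuum hγ hρs hε hx₀.symm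
    exact absurd h (hlt.trans (mul_vacuumPotential_sub_lt_totalJump hγ hε hl hr hρ hbdd)).ne'
  · obtain rfl : ρ = x := hunique _ ⟨hx₀, hx.2⟩ (hform.totalJump_eq hγ hρs hε hx₀)
    obtain rfl := h₁.unique h₁'
    obtain rfl := h₂.unique h₂'
    obtain ⟨hvel, -⟩ := hform.velocity_eq hγ hρs hε hx₀
    rw [← waveCurve_first_div w₁ hl.1 hx₀] at hvel
    rwa [← (div_left_inj' hx₀.ne').1 hvel]

lemma exists_isRiemannSolution_of_waveCurve_eq (hρ : ρ ∈ Ioo 0 ρs)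
    (h₁ : IsAdmissibleJump w₁ l.1 ρ) (h₂ : IsAdmissibleJump w₂ r.1 ρ)
    (h : waveCurve γ ρs ε .first w₁ l ρ = waveCurve γ ρs ε .second w₂ r ρ) :
    ∃ U, IsRiemannSolution γ ρs ε l r U := by
  have hρs := hl.1.trans hl.2
  obtain ⟨U₁, a₁, b₁, hU₁⟩ := exists_isWave_first
    (R := (ρ, waveCurve γ ρs ε .first w₁ l ρ)) hγ hε hl hρ h₁ (waveCurve_first_div _ hl.1 hρ.1)
  obtain ⟨U₂, a₂, b₂, hU₂⟩ := exists_isWave_second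
    (L := (ρ, waveCurve γ ρs ε .first w₁ l ρ)) hγ hε hρ hr h₂
    (h ▸ waveCurve_second_div _ hr.1 hρ.1)
  exact exists_isRiemannSolution_of_isWave hγ hε.le hU₁ hU₂
    ((hU₁.first_lt_velocity_right hγ hρs hε hρ.1).trans
      (hU₂.second_velocity_left_lt hγ hρs hε hρ.1))

lemma isIntersectionPoint_waveCurve (hρ : ρ ∈ Ioo 0 ρs)
    (h : waveCurve γ ρs ε .first w₁ l ρ = waveCurve γ ρs ε .second w₂ r ρ) :
    IsIntersectionPoint ρs (waveCurve γ ρs ε .first w₁ l) (waveCurve γ ρs ε .second w₂ r)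
      (ρ, waveCurve γ ρs ε .first w₁ l ρ) := by
  refine ⟨hρ.1.le, hρ.2, rfl, h, fun x hx₀ hxs hx => ?_⟩
  rw [waveCurve_first_eq_second_iff hl.1 hr.1 hx₀] at hx
  rw [waveCurve_first_eq_second_iff hl.1 hr.1 hρ.1] at h
  exact ((strictMonoOn_velocityJump w₁ hγ hε hl).add
    (strictMonoOn_velocityJump w₂ hγ hε hr)).injOn ⟨hx₀, hxs⟩ hρ (hx.trans h.symm)

lemma solvedByCurves_of_totalJump_eq (hρ : ρ ∈ Ioo 0 ρs) (h₁ : IsAdmissibleJump w₁ l.1 ρ)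
    (h₂ : IsAdmissibleJump w₂ r.1 ρ) (h : totalJump γ ρs ε l.1 r.1 ρ = l.2 / l.1 - r.2 / r.1) :
    SolvedByCurves γ ρs ε l r w₁ w₂ (ρ, waveCurve γ ρs ε .first w₁ l ρ) := by
  have hcurves : waveCurve γ ρs ε .first w₁ l ρ = waveCurve γ ρs ε .second w₂ r ρ := by
    rwa [waveCurve_first_eq_second_iff hl.1 hr.1 hρ.1, ← h₁.compositeJump_eq,
      ← h₂.compositeJump_eq]
  exact ⟨⟨exists_isRiemannSolution_of_waveCurve_eq hγ hε hl hr hρ h₁ h₂ hcurves,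
    fun U hU => hU.hasForm_of_totalJump_eq hγ hε hl hr hρ h₁ h₂ h⟩,
    isIntersectionPoint_waveCurve hγ hε hl hr hρ hcurves⟩

section Vacuum

variable (hbdd : BddBelow (soundPotential γ ρs '' Ioo 0 ρs))
  (h : l.2 / l.1 - r.2 / r.1 < √ε *
    (2 * vacuumPotential γ ρs - soundPotential γ ρs l.1 - soundPotential γ ρs r.1))

include hbdd h

lemma exists_isRiemannSolution_vacuum : ∃ U, IsRiemannSolution γ ρs ε l r U := by
  obtain ⟨U₁, a₁, hU₁⟩ := exists_isRarefaction_first_vacuum hγ hε hl hbdd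
  obtain ⟨U₂, a₂, hU₂⟩ := exists_isRarefaction_first_vacuum (L := reflect r) hγ hε hr hbdd
  have hU₂' := hU₂.reflect hγ hε.le
  rw [reflect_reflect, show reflect (0, 0) = (0, 0) by simp [reflect]] at hU₂'
  refine exists_isRiemannSolution_of_isWave (w₁ := .rarefaction) (w₂ := .rarefaction) hγ hε.le
    hU₁ hU₂' ?_
  simp only [riemannInvariant, reflect_fst, reflect_snd, neg_div]
  linarith

lemma IsRiemannSolution.hasForm_vacuum (hU : IsRiemannSolution γ ρs ε l r U) :
    HasForm γ ρs ε l r .rarefaction .rarefaction (0, 0) U := by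
  have hρs := hl.1.trans hl.2
  have hne : ∀ ρ ∈ Ioo 0 ρs, totalJump γ ρs ε l.1 r.1 ρ ≠ l.2 / l.1 - r.2 / r.1 := fun ρ hρ =>
    (h.trans (mul_vacuumPotential_sub_lt_totalJump hγ hε hl hr hρ hbdd)).ne'
  rcases hU.totalJump_eq_or_hasForm hγ hε hl hr with (hD | hD) | ⟨w₁, w₂, m, hform⟩
  · exact absurd hD (hne _ hl)
  · exact absurd hD (hne _ hr)
  have hm := hform.density_mem hγ hρs hε
  rcases hm.1.eq_or_lt with hm₀ | hm₀
  · obtain ⟨rfl, rfl, rfl, -⟩ := hform.vacuum hγ hρs hε hm₀.symm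
    exact hform
  · exact absurd (hform.totalJump_eq hγ hρs hε hm₀) (hne _ ⟨hm₀, hm.2⟩)

lemma solvedByCurves_vacuum : SolvedByCurves γ ρs ε l r .rarefaction .rarefaction (0, 0) := by
  refine ⟨⟨exists_isRiemannSolution_vacuum hγ hε hl hr hbdd h,
    fun U hU => hU.hasForm_vacuum hγ hε hl hr hbdd h⟩, le_rfl, hl.1.trans hl.2,
    (waveCurve_zero ..).symm, (waveCurve_zero ..).symm, fun ρ hρ₀ hρs hρ => ?_⟩
  rw [waveCurve_first_eq_second_iff hl.1 hr.1 hρ₀, velocityJump, velocityJump] at hρ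
  have hlt := mul_lt_mul_of_pos_left (vacuumPotential_lt_soundPotential hbdd hγ ⟨hρ₀, hρs⟩)
    (Real.sqrt_pos.2 hε)
  linarith

end Vacuum

lemma exists_solvedByCurves_shock_shock
    (h₁ : compositeJump γ ρs ε l.1 r.1 < l.2 / l.1 - r.2 / r.1)
    (h₂ : compositeJump γ ρs ε r.1 l.1 < l.2 / l.1 - r.2 / r.1) :
    ∃ m, SolvedByCurves γ ρs ε l r .shock .shock m := by
  rw [← totalJump_right] at h₁
  rw [← totalJump_left] at h₂
  have hmono := strictMonoOn_totalJump hγ hε hl hr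
  obtain ⟨ρ, hρ, hD⟩ := exists_totalJump_eq hγ hε hl hr hl h₂.le
  have hρI : ρ ∈ Ioo 0 ρs := ⟨hl.1.trans_le hρ.1, hρ.2⟩
  rw [← hD, hmono.lt_iff_lt hr hρI] at h₁
  rw [← hD, hmono.lt_iff_lt hl hρI] at h₂
  exact ⟨_, solvedByCurves_of_totalJump_eq (w₁ := .shock) (w₂ := .shock) hγ hε hl hr hρI h₂ h₁ hD⟩

lemma exists_solvedByCurves_shock_rarefaction
    (h₁ : l.2 / l.1 - r.2 / r.1 < compositeJump γ ρs ε l.1 r.1)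
    (h₂ : compositeJump γ ρs ε r.1 l.1 < l.2 / l.1 - r.2 / r.1) :
    ∃ m, SolvedByCurves γ ρs ε l r .shock .rarefaction m ∧ m.1 ∈ Icc l.1 r.1 := by
  rw [← totalJump_right] at h₁
  rw [← totalJump_left] at h₂
  have hmono := strictMonoOn_totalJump hγ hε hl hr
  obtain ⟨ρ, hρ, hD⟩ := exists_totalJump_eq hγ hε hl hr hl h₂.le
  have hρI : ρ ∈ Ioo 0 ρs := ⟨hl.1.trans_le hρ.1, hρ.2⟩
  rw [← hD, hmono.lt_iff_lt hρI hr] at h₁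
  rw [← hD, hmono.lt_iff_lt hl hρI] at h₂
  exact ⟨_, solvedByCurves_of_totalJump_eq (w₁ := .shock) (w₂ := .rarefaction) hγ hε hl hr hρI
    h₂ h₁ hD, h₂.le, h₁.le⟩

lemma exists_solvedByCurves_rarefaction_shock
    (h₁ : compositeJump γ ρs ε l.1 r.1 < l.2 / l.1 - r.2 / r.1)
    (h₂ : l.2 / l.1 - r.2 / r.1 < compositeJump γ ρs ε r.1 l.1) :
    ∃ m, SolvedByCurves γ ρs ε l r .rarefaction .shock m ∧ m.1 ∈ Icc r.1 l.1 := by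
  rw [← totalJump_right] at h₁
  rw [← totalJump_left] at h₂
  have hmono := strictMonoOn_totalJump hγ hε hl hr
  obtain ⟨ρ, hρ, hD⟩ := exists_totalJump_eq hγ hε hl hr hr h₁.le
  have hρI : ρ ∈ Ioo 0 ρs := ⟨hr.1.trans_le hρ.1, hρ.2⟩
  rw [← hD, hmono.lt_iff_lt hr hρI] at h₁
  rw [← hD, hmono.lt_iff_lt hρI hl] at h₂
  exact ⟨_, solvedByCurves_of_totalJump_eq (w₁ := .rarefaction) (w₂ := .shock) hγ hε hl hr hρI
    h₂ h₁ hD, h₁.le, h₂.le⟩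

lemma exists_solvedByCurves_rarefaction_rarefaction
    (h₁ : l.2 / l.1 - r.2 / r.1 < compositeJump γ ρs ε l.1 r.1)
    (h₂ : l.2 / l.1 - r.2 / r.1 < compositeJump γ ρs ε r.1 l.1)
    (h₀ : BddBelow (soundPotential γ ρs '' Ioo 0 ρs) → l.2 / l.1 - r.2 / r.1 < √ε *
      (2 * vacuumPotential γ ρs - soundPotential γ ρs l.1 - soundPotential γ ρs r.1)) :
    ∃ m, SolvedByCurves γ ρs ε l r .rarefaction .rarefaction m ∧ m.1 < l.1 ∧ m.1 < r.1 := by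
  by_cases hbdd : BddBelow (soundPotential γ ρs '' Ioo 0 ρs)
  · exact ⟨_, solvedByCurves_vacuum hγ hε hl hr hbdd (h₀ hbdd), hl.1, hr.1⟩
  rw [← totalJump_right] at h₁
  rw [← totalJump_left] at h₂
  have hmono := strictMonoOn_totalJump hγ hε hl hr
  obtain ⟨x, hx, hxD⟩ :=
    exists_totalJump_le_of_not_bddBelow hγ hε hl hr (l.2 / l.1 - r.2 / r.1) hbdd
  obtain ⟨ρ, hρ, hD⟩ := exists_totalJump_eq hγ hε hl hr hx hxD
  have hρI : ρ ∈ Ioo 0 ρs := ⟨hx.1.trans_le hρ.1, hρ.2⟩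
  rw [← hD, hmono.lt_iff_lt hρI hr] at h₁
  rw [← hD, hmono.lt_iff_lt hρI hl] at h₂
  exact ⟨_, solvedByCurves_of_totalJump_eq (w₁ := .rarefaction) (w₂ := .rarefaction) hγ hε hl hr
    hρI h₂ h₁ hD, h₂, h₁⟩

end Solving

section HugoniotCriteria

variable (hγ : 0 < γ) (hε : 0 < ε) (hl : l.1 ∈ Ioo 0 ρs) (hr : r.1 ∈ Ioo 0 ρs)

include hγ hε hl hr

lemma lt_hugoniotCurve_first_iff (hu : r.2 / r.1 < l.2 / l.1) :
    r.2 < hugoniotCurve γ ρs ε .first l r.1 ↔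
      compositeJump γ ρs ε l.1 r.1 < l.2 / l.1 - r.2 / r.1 := by
  rw [compositeJump_lt_iff hγ hε hl hr (sub_pos.2 hu), lt_sub_comm,
    ← waveCurve_first_div .shock hl.1 hr.1, div_lt_div_iff_of_pos_right hr.1, waveCurve]

lemma hugoniotCurve_first_lt_iff (hu : r.2 / r.1 ≤ l.2 / l.1) :
    hugoniotCurve γ ρs ε .first l r.1 < r.2 ↔
      l.2 / l.1 - r.2 / r.1 < compositeJump γ ρs ε l.1 r.1 := by
  rw [lt_compositeJump_iff hγ hε hl hr (sub_nonneg.2 hu), sub_lt_comm,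
    ← waveCurve_first_div .shock hl.1 hr.1, div_lt_div_iff_of_pos_right hr.1, waveCurve]

lemma hugoniotCurve_second_lt_iff (hu : r.2 / r.1 < l.2 / l.1) :
    hugoniotCurve γ ρs ε .second r l.1 < l.2 ↔
      compositeJump γ ρs ε r.1 l.1 < l.2 / l.1 - r.2 / r.1 := by
  rw [compositeJump_lt_iff hγ hε hr hl (sub_pos.2 hu), lt_sub_iff_add_lt',
    ← waveCurve_second_div .shock hr.1 hl.1, div_lt_div_iff_of_pos_right hl.1, waveCurve]

lemma lt_hugoniotCurve_second_iff (hu : r.2 / r.1 ≤ l.2 / l.1) :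
    l.2 < hugoniotCurve γ ρs ε .second r l.1 ↔
      l.2 / l.1 - r.2 / r.1 < compositeJump γ ρs ε r.1 l.1 := by
  rw [lt_compositeJump_iff hγ hε hr hl (sub_nonneg.2 hu), sub_lt_iff_lt_add',
    ← waveCurve_second_div .shock hr.1 hl.1, div_lt_div_iff_of_pos_right hl.1, waveCurve]

end HugoniotCriteria

/-! ### The limit `ε → 0⁺` -/

lemma exists_sqrt_mul_soundPotential_le {δ : ℝ} (hγ : 0 < γ) (hρs : 0 < ρs) (hδ : 0 < δ) :
    ∃ b ∈ Ioo 0 ρs, ∀ ε, 0 < ε → ∀ ρ ∈ Ioo 0 ρs, √ε * soundPotential γ ρs ρ ≤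
      √ε * soundPotential γ ρs b + δ / 2 * (ε * pressure γ ρs ρ + 1) := by
  obtain ⟨b, hb, hbδ⟩ := exists_density_of_excess hρs (pow_pos hδ 2)
  refine ⟨b, hb, fun ε hε ρ hρ => ?_⟩
  have hs := Real.sqrt_pos.2 hε
  rcases le_total ρ b with h | h
  · have := (strictMonoOn_soundPotential hγ).monotoneOn hρ hb h
    have := pressure_pos (γ := γ) hρ
    exact le_add_of_le_of_nonneg (by gcongr) (by positivity)
  have hc := mul_pos hs hδ
  have hexcess : 1 / b - 1 / ρ ≤ δ ^ 2 := by
    linarith [one_div_le_one_div_of_le hρ.1 hρ.2.le]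
  have hP : 2 * (soundPotential γ ρs ρ - soundPotential γ ρs b) ≤
      √ε * δ * pressure γ ρs ρ + (√ε * δ)⁻¹ * δ ^ 2 :=
    (two_mul_soundPotential_sub_le hγ hc hb.1 h hρ.2).trans (add_le_add
      (mul_le_mul_of_nonneg_left (sub_le_self _ (pressure_pos hb).le) hc.le)
      (mul_le_mul_of_nonneg_left hexcess (inv_pos.2 hc).le))
  have hscale : √ε * (√ε * δ * pressure γ ρs ρ + (√ε * δ)⁻¹ * δ ^ 2) =
      δ * (ε * pressure γ ρs ρ + 1) := by
    have := Real.sq_sqrt hε.le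
    field_simp
    rw [this]
    ring
  linarith [mul_le_mul_of_nonneg_left hP hs.le]

lemma tendsto_sqrt_mul_const_nhdsGT_zero (c : ℝ) :
    Tendsto (fun ε => √ε * c) (𝓝[>] 0) (𝓝 0) := by
  have h : Tendsto (fun ε => √ε * c) (𝓝 0) (𝓝 (√0 * c)) :=
    (Real.continuous_sqrt.mul continuous_const).tendsto 0
  rw [Real.sqrt_zero, zero_mul] at h
  exact h.mono_left nhdsWithin_le_nhds

lemma tendsto_sqrt_mul_soundPotential {d : ℝ → ℝ} (hγ : 0 < γ) (ha : 0 < a)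
    (hd : ∀ᶠ ε in 𝓝[>] 0, d ε ∈ Ico a ρs)
    (hp : IsBoundedUnder (· ≤ ·) (𝓝[>] 0) fun ε => ε * pressure γ ρs (d ε)) :
    Tendsto (fun ε => √ε * soundPotential γ ρs (d ε)) (𝓝[>] 0) (𝓝 0) := by
  have haI : a ∈ Ioo 0 ρs := ⟨ha, let ⟨_, h⟩ := hd.exists; h.1.trans_lt h.2⟩
  refine tendsto_order.2 ⟨fun K hK => ?_, fun K hK => ?_⟩
  · filter_upwards [hd, (tendsto_sqrt_mul_const_nhdsGT_zero (soundPotential γ ρs a)).eventually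
      (lt_mem_nhds hK)] with ε hdε hKε
    exact hKε.trans_le (mul_le_mul_of_nonneg_left ((strictMonoOn_soundPotential hγ).monotoneOn haI
      ⟨ha.trans_le hdε.1, hdε.2⟩ hdε.1) (Real.sqrt_nonneg ε))
  · obtain ⟨M, hM⟩ := hp
    obtain ⟨b, -, hb⟩ := exists_sqrt_mul_soundPotential_le hγ (haI.1.trans haI.2)
      (δ := K / (|M| + 1)) (by positivity)
    filter_upwards [hd, eventually_mem_nhdsWithin, eventually_map.1 hM,
      (tendsto_sqrt_mul_const_nhdsGT_zero (soundPotential γ ρs b)).eventually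
        (gt_mem_nhds (half_pos hK))] with ε hdε hε hMε hKε
    have hbound : K / (|M| + 1) / 2 * (ε * pressure γ ρs (d ε) + 1) ≤ K / 2 :=
      calc K / (|M| + 1) / 2 * (ε * pressure γ ρs (d ε) + 1)
          ≤ K / (|M| + 1) / 2 * (|M| + 1) := by gcongr; exact hMε.trans (le_abs_self M)
        _ = K / 2 := by field_simp
    linarith [hb ε hε (d ε) ⟨ha.trans_le hdε.1, hdε.2⟩]

lemma eventually_exists_solvedByCurves_rarefaction_rarefaction {l r : ℝ → ℝ × ℝ} {ul ur : ℝ}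
    (hγ : 0 < γ) (hl : ∀ ε, 0 < ε → (l ε).1 ∈ Ioo 0 ρs) (hr : ∀ ε, 0 < ε → (r ε).1 ∈ Ioo 0 ρs)
    (hlP : Tendsto (fun ε => √ε * soundPotential γ ρs (l ε).1) (𝓝[>] 0) (𝓝 0))
    (hrP : Tendsto (fun ε => √ε * soundPotential γ ρs (r ε).1) (𝓝[>] 0) (𝓝 0))
    (hlu : Tendsto (fun ε => (l ε).2 / (l ε).1) (𝓝[>] 0) (𝓝 ul))
    (hru : Tendsto (fun ε => (r ε).2 / (r ε).1) (𝓝[>] 0) (𝓝 ur)) (hu : ul < ur) :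
    ∀ᶠ ε in 𝓝[>] (0 : ℝ), ∃ m, SolvedByCurves γ ρs ε (l ε) (r ε) .rarefaction .rarefaction m ∧
      m.1 < (l ε).1 ∧ m.1 < (r ε).1 := by
  have hD := hlu.sub hru
  have hD₀ := sub_neg.2 hu
  have hlr := hrP.sub hlP
  have hrl := hlP.sub hrP
  have hvac := ((tendsto_sqrt_mul_const_nhdsGT_zero (2 * vacuumPotential γ ρs)).sub hlP).sub hrP
  rw [sub_zero] at hlr hrl
  rw [sub_zero, sub_zero] at hvac
  filter_upwards [eventually_mem_nhdsWithin, hD.eventually (gt_mem_nhds hD₀),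
    hD.eventually_lt hlr hD₀, hD.eventually_lt hrl hD₀, hD.eventually_lt hvac hD₀]
    with ε hε hneg hlr hrl hvac
  rw [← mul_sub] at hlr hrl
  rw [← mul_sub, ← mul_sub] at hvac
  have hlε := hl ε hε
  have hrε := hr ε hε
  exact exists_solvedByCurves_rarefaction_rarefaction hγ hε hlε hrε
    (lt_compositeJump_of_lt_rarefaction hγ hε hlε hrε hneg hlr)
    (lt_compositeJump_of_lt_rarefaction hγ hε hrε hlε hneg hrl) fun _ => hvac

theorem mainTheorem4_general
    (γ ρs : ℝ) (hγ : 0 < γ) (l r : ℝ → ℝ × ℝ)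
    (hl : ∀ ε, 0 < ε → (l ε).1 ∈ Ioo 0 ρs) (hr : ∀ ε, 0 < ε → (r ε).1 ∈ Ioo 0 ρs)
    (al ar ul ur : ℝ) (hal : 0 < al) (har : 0 < ar)
    (hal_le : ∀ᶠ ε in 𝓝[>] 0, al ≤ (l ε).1) (har_le : ∀ᶠ ε in 𝓝[>] 0, ar ≤ (r ε).1)
    (hpl : IsBoundedUnder (· ≤ ·) (𝓝[>] 0) fun ε => ε * pressure γ ρs (l ε).1)
    (hpr : IsBoundedUnder (· ≤ ·) (𝓝[>] 0) fun ε => ε * pressure γ ρs (r ε).1)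
    (hul : Tendsto (fun ε => (l ε).2 / (l ε).1) (𝓝[>] 0) (𝓝 ul))
    (hur : Tendsto (fun ε => (r ε).2 / (r ε).1) (𝓝[>] 0) (𝓝 ur)) :
    (ul < ur → ∀ᶠ ε in 𝓝[>] (0 : ℝ),
      ∃ m : ℝ × ℝ, SolvedByCurves γ ρs ε (l ε) (r ε) .rarefaction .rarefaction m ∧
        m.1 < (l ε).1 ∧ m.1 < (r ε).1) ∧
    (∀ ε, 0 < ε → (r ε).2 / (r ε).1 < (l ε).2 / (l ε).1 →
      (hugoniotCurve γ ρs ε .first (l ε) (r ε).1 > (r ε).2 →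
        hugoniotCurve γ ρs ε .second (r ε) (l ε).1 < (l ε).2 →
        ∃ m : ℝ × ℝ, SolvedByCurves γ ρs ε (l ε) (r ε) .shock .shock m) ∧
      (hugoniotCurve γ ρs ε .first (l ε) (r ε).1 < (r ε).2 →
        ∃ m : ℝ × ℝ, SolvedByCurves γ ρs ε (l ε) (r ε) .shock .rarefaction m) ∧
      (hugoniotCurve γ ρs ε .second (r ε) (l ε).1 > (l ε).2 →
        ∃ m : ℝ × ℝ, SolvedByCurves γ ρs ε (l ε) (r ε) .rarefaction .shock m)) ∧
    (∀ ε, 0 < ε → (l ε).2 / (l ε).1 = (r ε).2 / (r ε).1 →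
      ((l ε).1 < (r ε).1 →
        ∃ m : ℝ × ℝ, SolvedByCurves γ ρs ε (l ε) (r ε) .shock .rarefaction m ∧
          m.1 ∈ Icc (l ε).1 (r ε).1) ∧
      ((r ε).1 < (l ε).1 →
        ∃ m : ℝ × ℝ, SolvedByCurves γ ρs ε (l ε) (r ε) .rarefaction .shock m ∧
          m.1 ∈ Icc (r ε).1 (l ε).1)) := by
  refine ⟨eventually_exists_solvedByCurves_rarefaction_rarefaction hγ hl hr
    (tendsto_sqrt_mul_soundPotential hγ hal ?_ hpl)
    (tendsto_sqrt_mul_soundPotential hγ har ?_ hpr) hul hur, fun ε hε hu => ?_, fun ε hε hu => ?_⟩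
  · filter_upwards [eventually_mem_nhdsWithin, hal_le] with ε hε hle using ⟨hle, (hl ε hε).2⟩
  · filter_upwards [eventually_mem_nhdsWithin, har_le] with ε hε hle using ⟨hle, (hr ε hε).2⟩
  · have hlε := hl ε hε
    have hrε := hr ε hε
    refine ⟨fun h₁ h₂ => ?_, fun h => ?_, fun h => ?_⟩
    · exact exists_solvedByCurves_shock_shock hγ hε hlε hrε
        ((lt_hugoniotCurve_first_iff hγ hε hlε hrε hu).1 h₁)
        ((hugoniotCurve_second_lt_iff hγ hε hlε hrε hu).1 h₂)
    · rw [hugoniotCurve_first_lt_iff hγ hε hlε hrε hu.le] at h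
      exact (exists_solvedByCurves_shock_rarefaction hγ hε hlε hrε h
        (compositeJump_swap_lt hγ hε hlε hrε (sub_pos.2 hu).le h)).imp fun _ => And.left
    · rw [gt_iff_lt, lt_hugoniotCurve_second_iff hγ hε hlε hrε hu.le] at h
      exact (exists_solvedByCurves_rarefaction_shock hγ hε hlε hrε
        (compositeJump_swap_lt hγ hε hrε hlε (sub_pos.2 hu).le h) h).imp fun _ => And.left
  · have hlε := hl ε hε
    have hrε := hr ε hε
    have hD := sub_eq_zero.2 hu
    exact ⟨fun h => exists_solvedByCurves_shock_rarefaction hγ hε hlε hrε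
        (hD ▸ (compositeJump_pos_iff hγ hε hlε hrε).2 h)
        (hD ▸ (compositeJump_neg_iff hγ hε hrε hlε).2 h),
      fun h => exists_solvedByCurves_rarefaction_shock hγ hε hlε hrε
        (hD ▸ (compositeJump_neg_iff hγ hε hlε hrε).2 h)
        (hD ▸ (compositeJump_pos_iff hγ hε hrε hlε).2 h)⟩

theorem mainTheorem4
    (γ ρs : ℝ) (hγ : 0 < γ) (hρs : 0 < ρs)
    -- left and right states `(ρ, q)`, possibly depending on `ε`
    (l r : ℝ → ℝ × ℝ)
    (hl : ∀ ε, 0 < ε → 0 < (l ε).1 ∧ (l ε).1 < ρs)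
    (hr : ∀ ε, 0 < ε → 0 < (r ε).1 ∧ (r ε).1 < ρs)
    -- limits of the states and of the pressures; the limit densities may equal `ρs`
    (ρl ql pl ρr qr pr : ℝ) (hρl : 0 < ρl) (hρr : 0 < ρr)
    (hl_lim : Tendsto l (𝓝[>] 0) (𝓝 (ρl, ql)))
    (hr_lim : Tendsto r (𝓝[>] 0) (𝓝 (ρr, qr)))
    (hpl : Tendsto (fun ε => ε * pressure γ ρs (l ε).1) (𝓝[>] 0) (𝓝 pl))
    (hpr : Tendsto (fun ε => ε * pressure γ ρs (r ε).1) (𝓝[>] 0) (𝓝 pr)) :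
    (ql / ρl < qr / ρr → ∀ᶠ ε in 𝓝[>] (0 : ℝ),
      ∃ m : ℝ × ℝ, SolvedByCurves γ ρs ε (l ε) (r ε) .rarefaction .rarefaction m ∧
        m.1 < (l ε).1 ∧ m.1 < (r ε).1) ∧
    (∀ᶠ ε in 𝓝[>] (0 : ℝ), (r ε).2 / (r ε).1 < (l ε).2 / (l ε).1 →
      (hugoniotCurve γ ρs ε .first (l ε) (r ε).1 > (r ε).2 →
        hugoniotCurve γ ρs ε .second (r ε) (l ε).1 < (l ε).2 →
        ∃ m : ℝ × ℝ, SolvedByCurves γ ρs ε (l ε) (r ε) .shock .shock m) ∧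
      (hugoniotCurve γ ρs ε .first (l ε) (r ε).1 < (r ε).2 →
        ∃ m : ℝ × ℝ, SolvedByCurves γ ρs ε (l ε) (r ε) .shock .rarefaction m) ∧
      (hugoniotCurve γ ρs ε .second (r ε) (l ε).1 > (l ε).2 →
        ∃ m : ℝ × ℝ, SolvedByCurves γ ρs ε (l ε) (r ε) .rarefaction .shock m)) ∧
    (∀ ε, 0 < ε → (l ε).2 / (l ε).1 = (r ε).2 / (r ε).1 →
      ((l ε).1 < (r ε).1 →
        ∃ m : ℝ × ℝ, SolvedByCurves γ ρs ε (l ε) (r ε) .shock .rarefaction m ∧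
          m.1 ∈ Icc (l ε).1 (r ε).1) ∧
      ((r ε).1 < (l ε).1 →
        ∃ m : ℝ × ℝ, SolvedByCurves γ ρs ε (l ε) (r ε) .rarefaction .shock m ∧
          m.1 ∈ Icc (r ε).1 (l ε).1)) := by
  obtain ⟨h₁, h₂, h₃⟩ := mainTheorem4_general γ ρs hγ l r hl hr (ρl / 2) (ρr / 2)
    (ql / ρl) (qr / ρr) (half_pos hρl) (half_pos hρr)
    (hl_lim.fst_nhds.eventually_const_le (half_lt_self hρl))
    (hr_lim.fst_nhds.eventually_const_le (half_lt_self hρr)) hpl.isBoundedUnder_le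
    hpr.isBoundedUnder_le (hl_lim.snd_nhds.div hl_lim.fst_nhds hρl.ne')
    (hr_lim.snd_nhds.div hr_lim.fst_nhds hρr.ne')
  exact ⟨h₁, eventually_mem_nhdsWithin.mono h₂, h₃⟩
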